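/- Setting. Let $w$ be an $m$-dimensional Wiener process with respect to a filtration $(\mathcal F_t)_{t\ge 0}$ on a probability space $(\Omega,\mathcal F,\mathbb P)$. Let $f:\mathbb R^d\times\mathbb R^d\to\mathbb R^d$ and $g:\mathbb R^d\times\mathbb R^d\to\mathbb R^{d\times m}$ be continuous, let $\tau:[0,\infty)\to[0,\infty)$ be such that $-\bar\tau:=\inf\{t-\tau(t):t\ge 0\}$ is finite, and let $\psi(s)$, $s\in[-\bar\tau,0]$, be $\mathcal F_0$-measurable $\mathbb R^d$-valued initial data with $\mathbb E\sup_{-\bar\tau\le s\le 0}|\psi(s)|^q<\infty$ for all $q>0$. Here $|\cdot|$ is the Euclidean norm on vectors and the Frobenius norm on matrices. For a step size $h>0$ put $t_n=nh$. The split-step backward Euler method with interpolation weights $\mu_n\in[0,1)$ is $y_0=\psi(0)$ and, for $n\ge 0$, $$y_n^*=y_n+h f(y_n^*,\tilde y_n^*),\qquad y_{n+1}=y_n^*+g(y_n^*,\tilde y_n^*)\,(w(t_{n+1})-w(t_n)),$$ where $\tilde y_n^*=\psi(t_n-\tau(t_n))$ if $t_n-\tau(t_n)<0$; $\tilde y_n^*=\mu_n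 y^*_{n-q_n+1}+(1-\mu_n)y^*_{n-q_n}$ if $0\le t_n-\tau(t_n)\in[t_{n-q_n},t_{n-q_n+1})$ with an integer $q_n\ge 1$; and $\tilde y_n^*=y_n^*$ if $\tau(t_n)=0$. It is assumed that the implicit equation for $y_n^*$ is uniquely solvable at every step. For $t\in[t_n,t_{n+1})$, $n\ge 0$, put $\tilde y^*(t)=\tilde y_n^*$ and $$\bar y(t)=y_n+(t-t_n)f(y_n^*,\tilde y_n^*)+g(y_n^*,\tilde y_n^*)\,(w(t)-w(t_n)),$$ and $\bar y(t)=\psi(t)$ for $-\bar\tau\le t\le 0$. Lemma. Suppose that for some constant $K$ $$x^{T}f(x,y)\,\vee\,|g(x,y)|^2\le K(1+|x|^2+|y|^2)\qquad\text{for all }x,y\in\mathbb R^d .$$ Then there is $h_0\in(0,1)$ such that for all $T\ge 0$ and all real $p\ge 2$ there is a constant $A$, independent of $h$ and of the weights $\mu_n$, such that for all $0<h<h_0$ $$\mathbb E\Big[\sup_{0\le nh\le T}|y_n^*|^{2p}\Big]\vee\mathbb E\Big[\sup_{0\le t\le T}|\tilde y^*(t)|^{2p}\Big]\vee\mathbb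 E\Big[\sup_{0\le t\le T}|\bar y(t)|^{2p}\Big]\le A .$$ -/

import Mathlib

open MeasureTheory ProbabilityTheory Set
open scoped NNReal ENNReal

noncomputable section

namespace SSBE

/-- `ℝ^d` with the Euclidean norm. -/
abbrev Vec (d : ℕ) : Type := EuclideanSpace ℝ (Fin d)

/-- The square of the trace (Frobenius) norm of a matrix. -/
def frobSq {d m : ℕ} (A : Matrix (Fin d) (Fin m) ℝ) : ℝ := ∑ i, ∑ j, A i j ^ 2

/-- Matrix-vector product, as a vector of Euclidean space. -/
def applyMat {d m : ℕ} (A : Matrix (Fin d) (Fin m) ℝ) (v : Vec m) : Vec d :=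
  WithLp.toLp 2 (A.mulVec v.ofLp)

/-- The monotone growth condition `xᵀ f(x,y) ∨ |g(x,y)|² ≤ K (1 + |x|² + |y|²)`. -/
def MonotoneGrowth {d m : ℕ} (f : Vec d → Vec d → Vec d)
    (g : Vec d → Vec d → Matrix (Fin d) (Fin m) ℝ) (K : ℝ) : Prop :=
  ∀ x y : Vec d, max (inner ℝ x (f x y)) (frobSq (g x y)) ≤ K * (1 + ‖x‖ ^ 2 + ‖y‖ ^ 2)

/-- `w` is a standard `m`-dimensional Wiener process with respect to the filtration `ℱ`. The law
`N(0, (t - s) I)` is written as the image of the standard Gaussian law under scaling by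
`√(t - s)`. -/
structure IsWiener {Ω : Type*} [MeasurableSpace Ω] {m : ℕ} (P : Measure Ω)
    (ℱ : Filtration ℝ≥0 (inferInstance : MeasurableSpace Ω)) (w : ℝ≥0 → Ω → Vec m) : Prop where
  adapted : ∀ t, Measurable[ℱ t] (w t)
  zero : ∀ᵐ ω ∂P, w 0 ω = 0
  cont : ∀ᵐ ω ∂P, Continuous fun t => w t ω
  law : ∀ s t : ℝ≥0, s ≤ t → HasLaw (fun ω => w t ω - w s ω)
    ((stdGaussian (Vec m)).map fun v => √((t : ℝ) - s) • v) P
  indep : ∀ s t : ℝ≥0, s ≤ t →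
    Indep (MeasurableSpace.comap (fun ω => w t ω - w s ω) inferInstance) (ℱ s) P

/-- The number `q_n` of grid steps by which the memory reaches back at time `t_n = n h`: when
`t_n - τ(t_n) ≥ 0` it is determined by `t_n - τ(t_n) ∈ [t_{n - q_n}, t_{n - q_n + 1})`. -/
def delaySteps (h : ℝ) (τ : ℝ → ℝ) (n : ℕ) : ℕ := n - ⌊(n * h - τ (n * h)) / h⌋₊

theorem delaySteps_spec {h : ℝ} (hh : 0 < h) {τ : ℝ → ℝ} {n : ℕ} (h0 : 0 ≤ τ (n * h))
    (h1 : 0 ≤ n * h - τ (n * h)) :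
    delaySteps h τ n ≤ n ∧
    n * h - τ (n * h) ∈ Ico (((n - delaySteps h τ n : ℕ) : ℝ) * h)
      (((n - delaySteps h τ n + 1 : ℕ) : ℝ) * h) ∧
    (delaySteps h τ n = 0 ↔ τ (n * h) = 0) := by
  have hle : ⌊(n * h - τ (n * h)) / h⌋₊ ≤ n := by
    apply Nat.floor_le_of_le
    rw [div_le_iff₀ hh]; linarith
  have e : n - delaySteps h τ n = ⌊(n * h - τ (n * h)) / h⌋₊ := by
    unfold delaySteps; omega
  refine ⟨Nat.sub_le _ _, ?_, ?_⟩
  · rw [e]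
    refine ⟨?_, ?_⟩
    · rw [← le_div_iff₀ hh]
      exact Nat.floor_le (div_nonneg h1 hh.le)
    · rw [← div_lt_iff₀ hh]
      push_cast
      exact Nat.lt_floor_add_one _
  · constructor
    · intro hq
      have e2 : n = ⌊(n * h - τ (n * h)) / h⌋₊ := by rw [← e, hq]; simp
      have := Nat.floor_le (div_nonneg h1 hh.le)
      rw [← e2, le_div_iff₀ hh] at this
      linarith
    · intro hz
      unfold delaySteps
      rw [hz, sub_zero, mul_div_assoc, div_self hh.ne', mul_one, Nat.floor_natCast, Nat.sub_self]

/-- The memory value `ỹ*_n` along one path, computed from the initial path `ψ` and the stages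
`y*_0, …, y*_n`. Here `μ n` is the interpolation weight of step `n`. If `τ(t_n) = 0`
(that is, `q_n = 0`), there is nothing to interpolate and the memory value is `y*_n`. -/
def memory {d : ℕ} (h : ℝ) (τ : ℝ → ℝ) (μ : ℕ → ℝ) (ψ : ℝ → Vec d) (ystar : ℕ → Vec d)
    (n : ℕ) : Vec d :=
  if n * h - τ (n * h) < 0 then ψ (n * h - τ (n * h))
  else if delaySteps h τ n = 0 then ystar n
  else μ n • ystar (n - delaySteps h τ n + 1) + (1 - μ n) • ystar (n - delaySteps h τ n)

/-- `(y, y*)` is the split-step backward Euler solution with step size `h` along one path, driven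
by the path `w` and started from the initial path `ψ`. The field `unique` says that each implicit
stage equation, in which the memory value may itself involve the unknown `c`, has no other
solution. -/
structure IsNumericalSolution {d m : ℕ} (f : Vec d → Vec d → Vec d)
    (g : Vec d → Vec d → Matrix (Fin d) (Fin m) ℝ) (h : ℝ) (τ : ℝ → ℝ) (μ : ℕ → ℝ)
    (ψ : ℝ → Vec d) (w : ℝ≥0 → Vec m) (y ystar : ℕ → Vec d) : Prop where
  init : y 0 = ψ 0
  stage : ∀ n, ystar n = y n + h • f (ystar n) (memory h τ μ ψ ystar n)
  unique : ∀ n c, c = y n + h • f c (memory h τ μ ψ (Function.update ystar n c) n) → c = ystar n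
  step : ∀ n, y (n + 1) = ystar n + applyMat (g (ystar n) (memory h τ μ ψ ystar n))
    (w (Real.toNNReal ((n + 1 : ℕ) * h)) - w (Real.toNNReal (n * h)))

/-- The index `n` with `t ∈ [t_n, t_{n+1})`, for `t ≥ 0`. -/
def gridIndex (h t : ℝ) : ℕ := ⌊t / h⌋₊

/-- The step function `ỹ*(t)`, equal to `ỹ*_n` for `t ∈ [t_n, t_{n+1})`. -/
def memoryCont {d : ℕ} (h : ℝ) (τ : ℝ → ℝ) (μ : ℕ → ℝ) (ψ : ℝ → Vec d) (ystar : ℕ → Vec d)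
    (t : ℝ) : Vec d :=
  memory h τ μ ψ ystar (gridIndex h t)

/-- The continuous-time approximation `ȳ(t)`: it is `ψ(t)` for `t ≤ 0` and
`y_n + (t - t_n) f(y*_n, ỹ*_n) + g(y*_n, ỹ*_n) (w(t) - w(t_n))` for `t ∈ [t_n, t_{n+1})`. -/
def contApprox {d m : ℕ} (f : Vec d → Vec d → Vec d)
    (g : Vec d → Vec d → Matrix (Fin d) (Fin m) ℝ) (h : ℝ) (τ : ℝ → ℝ) (μ : ℕ → ℝ)
    (ψ : ℝ → Vec d) (w : ℝ≥0 → Vec m) (y ystar : ℕ → Vec d) (t : ℝ) : Vec d :=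
  if t ≤ 0 then ψ t
  else
    y (gridIndex h t)
      + (t - gridIndex h t * h) •
          f (ystar (gridIndex h t)) (memory h τ μ ψ ystar (gridIndex h t))
      + applyMat (g (ystar (gridIndex h t)) (memory h τ μ ψ ystar (gridIndex h t)))
          (w (Real.toNNReal t) - w (Real.toNNReal (gridIndex h t * h)))

end SSBE

end

/-!
The proof rests on one scalar process, the *energy* `X`. Write `z` for the stages `y*`, `v` for the
memory values, `κ = max K 1` and `c n = 1 + |z n|² + |v n|²`. The monotone growth condition gives
`|z n|² ≤ |y n|² + 2 h κ c n`, and expanding `|y (n + 1)|²` shows that `|y n|² ≤ X n`, where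
`X 0 = |y 0|²` and

  `X (n + 1) = X n + √h ⟨2 gᵀ z n, ζ n⟩ + h (2 κ c n + |g ζ n|²)`

with `ζ n` a standard Gaussian vector independent of the past (`IsScheme.isEnergyScheme`). Thus `X`
is a nonnegative submartingale.

*Moments at fixed times.* Expanding `X (n + 1) ^ k`, the term of order `√h` has mean zero and the
remainder has mean of order `h` (`integral_pow_step_le`). The stage is bounded by `X n` up to a
relative error of order `h`, because for `8 κ h ≤ 1` the implicit term can be absorbed
(`IsEnergyScheme.b_le_add_mul`); this threshold does not depend on `k`. The memory contributes only
earlier stages and the initial path, so a Gronwall argument for the two interlaced sequences of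
moments of `X` and of the stages (`interlaced_gronwall`) bounds all moments on `[0, T]`, uniformly
in `h` and in the interpolation weights (`IsEnergyScheme.integral_pow_le`).

*Suprema.* Doob's quadratic maximal inequality, in the pathwise form `partialSups_sq_add_le`, is
applied to `X ^ k` and bounds the mean of the maximum of `X ^ (2 * k)` over the grid. The stages
exceed `X` by terms carrying a factor `h`, whose maximum over the grid is at most their sum, and the
memory is bounded by the stages and the initial path. Between grid points, `ȳ` is a convex
combination of `y n` and `z n` plus `g` times a Wiener increment; the supremum of the increment is
controlled by Doob's inequality on finer and finer grids
(`IsWiener.exists_lintegral_le_of_increment`), and the sum over the `T / h` steps is harmless since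
high powers of the increment are of order at most `h²`.

Independence requires the stages to be measurable with respect to the past. They are given only
implicitly, and their measurability follows from uniqueness of the solution of the stage equation
(`measurable_of_unique_zero`).
-/

noncomputable section

namespace SSBE

/-! ### Random variables with moments of all orders -/

/-- The random variable `X` has finite absolute moments of every order. -/
@[fun_prop]
def AllMoments {Ω E : Type*} [MeasurableSpace Ω] [NormedAddCommGroup E] (X : Ω → E)
    (P : Measure Ω) : Prop :=
  ∀ p : ℝ≥0, MemLp X p P

namespace AllMoments

variable {Ω E : Type*} [MeasurableSpace Ω] [NormedAddCommGroup E] {P : Measure Ω}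

theorem aestronglyMeasurable {X : Ω → E} (hX : AllMoments X P) : AEStronglyMeasurable X P :=
  (hX 1).1

theorem integrable {X : Ω → E} (hX : AllMoments X P) : Integrable X P :=
  memLp_one_iff_integrable.1 (by simpa using hX 1)

@[fun_prop]
theorem const [IsFiniteMeasure P] (a : E) : AllMoments (fun _ : Ω => a) P :=
  fun _ => memLp_const a

@[fun_prop]
theorem add {X Y : Ω → E} (hX : AllMoments X P) (hY : AllMoments Y P) :
    AllMoments (fun ω => X ω + Y ω) P :=
  fun p => (hX p).add (hY p)

@[fun_prop]
theorem sub {X Y : Ω → E} (hX : AllMoments X P) (hY : AllMoments Y P) :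
    AllMoments (fun ω => X ω - Y ω) P :=
  fun p => (hX p).sub (hY p)

@[fun_prop]
theorem norm {X : Ω → E} (hX : AllMoments X P) : AllMoments (fun ω => ‖X ω‖) P :=
  fun p => (hX p).norm

@[fun_prop]
theorem mul {X Y : Ω → ℝ} (hX : AllMoments X P) (hY : AllMoments Y P) :
    AllMoments (fun ω => X ω * Y ω) P := by
  intro p
  have : ENNReal.HolderTriple ((2 * p : ℝ≥0) : ℝ≥0∞) ((2 * p : ℝ≥0) : ℝ≥0∞) (p : ℝ≥0∞) := by
    refine ⟨?_⟩
    push_cast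
    rw [ENNReal.mul_inv (by simp) (by simp), ← add_mul, ENNReal.inv_two_add_inv_two, one_mul]
  exact (hY (2 * p)).mul' (hX (2 * p))

@[fun_prop]
theorem pow [IsFiniteMeasure P] {X : Ω → ℝ} (hX : AllMoments X P) (k : ℕ) :
    AllMoments (fun ω => X ω ^ k) P := by
  induction k with
  | zero => simpa using const (P := P) (1 : ℝ)
  | succ k ih => simpa only [pow_succ] using ih.mul hX

theorem finset_sum {ι : Type*} {X : ι → Ω → E} (s : Finset ι)
    (hX : ∀ i ∈ s, AllMoments (X i) P) : AllMoments (fun ω => ∑ i ∈ s, X i ω) P :=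
  fun p => memLp_finsetSum _ fun i hi => hX i hi p

theorem mono {F : Type*} [NormedAddCommGroup F] {X : Ω → E} {Y : Ω → F} (hY : AllMoments Y P)
    (hX : AEStronglyMeasurable X P) (h : ∀ ω, ‖X ω‖ ≤ ‖Y ω‖) : AllMoments X P :=
  fun p => (hY p).of_le hX (.of_forall h)

theorem mono_real {X : Ω → E} {Y : Ω → ℝ} (hY : AllMoments Y P)
    (hX : AEStronglyMeasurable X P) (h : ∀ ω, ‖X ω‖ ≤ Y ω) : AllMoments X P :=
  hY.mono hX fun ω => (h ω).trans (le_abs_self _)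

theorem of_sq {X : Ω → E} [IsFiniteMeasure P] (hX : AEStronglyMeasurable X P)
    (h : AllMoments (fun ω => ‖X ω‖ ^ 2) P) : AllMoments X P :=
  (h.add (const 1)).mono_real hX fun ω => by nlinarith [sq_nonneg (‖X ω‖ - 1)]

@[fun_prop]
theorem inner {m : ℕ} {X Y : Ω → Vec m} (hX : AllMoments X P) (hY : AllMoments Y P) :
    AllMoments (fun ω => inner ℝ (X ω) (Y ω)) P :=
  (hX.norm.mul hY.norm).mono_real
    (hX.aestronglyMeasurable.inner hY.aestronglyMeasurable)
    fun ω => norm_inner_le_norm (X ω) (Y ω)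

@[fun_prop]
theorem smul {m : ℕ} {X : Ω → ℝ} {Y : Ω → Vec m} (hX : AllMoments X P) (hY : AllMoments Y P) :
    AllMoments (fun ω => X ω • Y ω) P :=
  (hX.norm.mul hY.norm).mono_real
    (hX.aestronglyMeasurable.smul hY.aestronglyMeasurable)
    fun ω => (norm_smul (X ω) (Y ω)).le

@[fun_prop]
theorem max {X Y : Ω → ℝ} (hX : AllMoments X P) (hY : AllMoments Y P) :
    AllMoments (fun ω => max (X ω) (Y ω)) P :=
  fun p => (hX p).sup (hY p)

@[fun_prop]
theorem partialSups {x : ℕ → Ω → ℝ} (hx : ∀ n, AllMoments (x n) P) (n : ℕ) :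
    AllMoments (fun ω => partialSups (fun i => x i ω) n) P := by
  induction n with
  | zero => simpa using hx 0
  | succ n ih => simpa only [partialSups_add_one] using ih.max (hx (n + 1))

end AllMoments

/-! ### Power inequalities -/

/-- Taylor expansion of `x ↦ x ^ k` to first order, with a remainder that is quadratic in the
relative size `u` of the increment. -/
theorem abs_add_pow_sub_le {a c e u : ℝ} (ha : |a| ≤ c) (hu : 0 ≤ u) (he : |e| ≤ c * u) (k : ℕ) :
    |(a + e) ^ k - a ^ k - k * a ^ (k - 1) * e| ≤ k ^ 2 * c ^ k * u ^ 2 * (1 + u) ^ k := by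
  have hc : 0 ≤ c := (abs_nonneg a).trans ha
  induction k with
  | zero => simp
  | succ k ih =>
    have hk : (k : ℝ) * a ^ k = k * a ^ (k - 1) * a := by
      cases k with
      | zero => simp
      | succ k => simp [pow_succ]; ring
    have key : (a + e) ^ (k + 1) - a ^ (k + 1) - ((k + 1 : ℕ) : ℝ) * a ^ (k + 1 - 1) * e
        = (a + e) * ((a + e) ^ k - a ^ k - k * a ^ (k - 1) * e) + k * a ^ (k - 1) * e ^ 2 := by
      rw [Nat.add_sub_cancel]
      push_cast
      linear_combination (-e) * hk
    have h1 : |a + e| ≤ c * (1 + u) := (abs_add_le a e).trans (by linarith)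
    have h2 : |(k : ℝ) * a ^ (k - 1) * e ^ 2| ≤ k * c ^ (k + 1) * u ^ 2 := by
      rcases Nat.eq_zero_or_pos k with rfl | hk0
      · simp
      · have e1 : c ^ (k + 1) = c ^ (k - 1) * c ^ 2 := by rw [← pow_add]; congr 1; omega
        rw [abs_mul, abs_mul, abs_pow, abs_pow, Nat.abs_cast, e1]
        calc (k : ℝ) * |a| ^ (k - 1) * |e| ^ 2 ≤ k * c ^ (k - 1) * (c * u) ^ 2 := by gcongr
          _ = _ := by ring
    have h3 : u ^ 2 ≤ u ^ 2 * (1 + u) ^ (k + 1) :=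
      le_mul_of_one_le_right (sq_nonneg u) (one_le_pow₀ (by linarith))
    rw [key]
    calc _ ≤ |a + e| * |(a + e) ^ k - a ^ k - k * a ^ (k - 1) * e|
            + |(k : ℝ) * a ^ (k - 1) * e ^ 2| := by
          rw [← abs_mul]; exact abs_add_le _ _
      _ ≤ c * (1 + u) * (k ^ 2 * c ^ k * u ^ 2 * (1 + u) ^ k) + k * c ^ (k + 1) * u ^ 2 := by
          gcongr
      _ ≤ c * (1 + u) * (k ^ 2 * c ^ k * u ^ 2 * (1 + u) ^ k)
            + k * c ^ (k + 1) * (u ^ 2 * (1 + u) ^ (k + 1)) := by gcongr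
      _ = (k ^ 2 + k) * (c ^ (k + 1) * u ^ 2 * (1 + u) ^ (k + 1)) := by ring
      _ ≤ ((k + 1 : ℕ) : ℝ) ^ 2 * (c ^ (k + 1) * u ^ 2 * (1 + u) ^ (k + 1)) := by
          gcongr
          push_cast
          nlinarith [(Nat.cast_nonneg k : (0 : ℝ) ≤ k)]
      _ = _ := by ring

/-- The tangent line inequality for `x ↦ x ^ k` on the nonnegative half line. -/
theorem mul_pow_mul_sub_le {u v : ℝ} (hu : 0 ≤ u) (hv : 0 ≤ v) (k : ℕ) :
    k * v ^ (k - 1) * (u - v) ≤ u ^ k - v ^ k := by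
  induction k with
  | zero => simp
  | succ k ih =>
    have hk : (k : ℝ) * v ^ k = k * v ^ (k - 1) * v := by
      cases k with
      | zero => simp
      | succ k => simp [pow_succ]; ring
    have h1 := mul_le_mul_of_nonneg_left ih hu
    have h2 : 0 ≤ (k : ℝ) * v ^ (k - 1) * (u - v) ^ 2 := by positivity
    rw [Nat.add_sub_cancel, pow_succ, pow_succ]
    push_cast
    linear_combination h1 + h2 + (u - v) * hk

theorem add_pow_le_two_pow {a b : ℝ} (ha : 0 ≤ a) (hb : 0 ≤ b) (k : ℕ) :
    (a + b) ^ k ≤ 2 ^ k * (a ^ k + b ^ k) := by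
  refine (add_pow_le ha hb k).trans ?_
  gcongr
  · norm_num
  · omega

/-- A perturbation of relative size `h ≤ 1` changes a `k`-th power by order `h`. -/
theorem add_mul_pow_le {x y h : ℝ} (hx : 0 ≤ x) (hy : 0 ≤ y) (h0 : 0 ≤ h) (h1 : h ≤ 1)
    (k : ℕ) : (x + h * y) ^ k ≤ x ^ k + h * (x + y) ^ k := by
  have := (convexOn_pow (𝕜 := ℝ) k).2 (show x ∈ Ici 0 from hx)
    (show x + y ∈ Ici 0 from add_nonneg hx hy) (show 0 ≤ 1 - h by linarith) h0 (by ring)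
  simp only [smul_eq_mul] at this
  rw [show x + h * y = (1 - h) * x + h * (x + y) by ring]
  nlinarith [mul_nonneg h0 (pow_nonneg hx k)]

/-! ### Doob's quadratic maximal inequality -/

/-- The pathwise form of Doob's quadratic maximal inequality. -/
theorem partialSups_sq_add_le (x : ℕ → ℝ) (n : ℕ) :
    (partialSups x n) ^ 2 + 4 * ∑ i ∈ Finset.range n, partialSups x i * (x (i + 1) - x i)
      ≤ 4 * x n ^ 2 := by
  have key : 4 * ∑ i ∈ Finset.range n, partialSups x i * (x (i + 1) - x i)
      ≤ 4 * partialSups x n * x n - 2 * (partialSups x n) ^ 2 := by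
    induction n with
    | zero => simp; nlinarith [sq_nonneg (x 0)]
    | succ n ih =>
      rw [Finset.sum_range_succ, partialSups_add_one, mul_add]
      rcases le_total (partialSups x n) (x (n + 1)) with h | h
      · rw [sup_of_le_right h]
        nlinarith [sq_nonneg (x (n + 1) - partialSups x n)]
      · rw [sup_of_le_left h]
        nlinarith
  nlinarith [sq_nonneg (partialSups x n - 2 * x n)]

/-- Doob's quadratic maximal inequality for a process whose increments are
nonnegative on average against the running maximum. -/
theorem integral_partialSups_sq_le {Ω : Type*} [MeasurableSpace Ω] {P : Measure Ω}
    [IsProbabilityMeasure P] {x : ℕ → Ω → ℝ} (hx : ∀ n, AllMoments (x n) P)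
    (hinc : ∀ n, 0 ≤ ∫ ω, partialSups (fun i => x i ω) n * (x (n + 1) ω - x n ω) ∂P) (n : ℕ) :
    ∫ ω, (partialSups (fun i => x i ω) n) ^ 2 ∂P ≤ 4 * ∫ ω, x n ω ^ 2 ∂P := by
  have hM : ∀ i, AllMoments
      (fun ω => partialSups (fun i => x i ω) i * (x (i + 1) ω - x i ω)) P :=
    fun i => (AllMoments.partialSups hx i).mul ((hx _).sub (hx _))
  have hS := AllMoments.finset_sum (Finset.range n) fun i _ => hM i
  have h := integral_mono
    ((((AllMoments.partialSups hx n).pow 2).add ((AllMoments.const 4).mul hS)).integrable)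
    ((AllMoments.const 4).mul ((hx n).pow 2)).integrable
    (fun ω => partialSups_sq_add_le (fun i => x i ω) n)
  rw [integral_add ((AllMoments.partialSups hx n).pow 2).integrable
      ((AllMoments.const 4).mul hS).integrable, integral_const_mul, integral_const_mul,
    integral_finsetSum _ fun i _ => (hM i).integrable] at h
  have := Finset.sum_nonneg fun i (_ : i ∈ Finset.range n) => hinc i
  linarith

/-! ### Independent standard Gaussian increments -/

/-- The random vector `ζ` has the standard Gaussian law and is independent of the
`σ`-algebra `𝒢`. -/
structure IsStdGaussianIndep {Ω : Type*} {m : ℕ} (𝒢 : MeasurableSpace Ω)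
    [mΩ : MeasurableSpace Ω] (P : Measure Ω) (ζ : Ω → Vec m) : Prop where
  le : 𝒢 ≤ mΩ
  measurable : Measurable ζ
  map_eq : P.map ζ = stdGaussian (Vec m)
  indep : Indep (MeasurableSpace.comap ζ inferInstance) 𝒢 P

namespace IsStdGaussianIndep

variable {Ω : Type*} {m : ℕ} {𝒢 : MeasurableSpace Ω} [mΩ : MeasurableSpace Ω]
  {P : Measure Ω}  {ζ : Ω → Vec m}

theorem allMoments (hζ : IsStdGaussianIndep 𝒢 P ζ) : AllMoments ζ P := by
  intro p
  have := IsGaussian.memLp_id (stdGaussian (Vec m)) p (by simp)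
  rw [← hζ.map_eq] at this
  exact this.comp_of_map hζ.measurable.aemeasurable

theorem integral_comp (hζ : IsStdGaussianIndep 𝒢 P ζ) {φ : Vec m → ℝ} (hφ : Continuous φ) :
    ∫ ω, φ (ζ ω) ∂P = ∫ z, φ z ∂(stdGaussian (Vec m)) := by
  rw [← hζ.map_eq, integral_map hζ.measurable.aemeasurable hφ.aestronglyMeasurable]

theorem indepFun (hζ : IsStdGaussianIndep 𝒢 P ζ) {E : Type*} [mE : MeasurableSpace E]
    {V : Ω → E} (hV : Measurable[𝒢] V) : V ⟂ᵢ[P] ζ := by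
  rw [IndepFun_iff_Indep]
  exact (indep_of_indep_of_le_right hζ.indep hV.comap_le).symm

/-- Independence factorises the expectation of a product. -/
theorem integral_mul_comp (hζ : IsStdGaussianIndep 𝒢 P ζ) {V : Ω → ℝ} (hV : Measurable[𝒢] V)
    {φ : Vec m → ℝ} (hφ : Continuous φ) :
    ∫ ω, V ω * φ (ζ ω) ∂P = (∫ ω, V ω ∂P) * ∫ z, φ z ∂(stdGaussian (Vec m)) := by
  rw [← hζ.integral_comp hφ]
  exact ((hζ.indepFun hV).comp measurable_id hφ.measurable).integral_fun_mul_eq_mul_integral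
    (hV.mono hζ.le le_rfl).aestronglyMeasurable
    (hφ.measurable.comp hζ.measurable).aestronglyMeasurable

/-- A Gaussian increment is orthogonal to the past. -/
theorem integral_inner_eq_zero [IsProbabilityMeasure P] (hζ : IsStdGaussianIndep 𝒢 P ζ)
    {V : Ω → Vec m} (hV : Measurable[𝒢] V) (hVm : AllMoments V P) :
    ∫ ω, inner ℝ (V ω) (ζ ω) ∂P = 0 := by
  have hc : ∀ i : Fin m, Continuous fun z : Vec m => z i := fun i => by fun_prop
  have hVi : ∀ i : Fin m, AllMoments (fun ω => V ω i) P := fun i =>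
    hVm.mono ((hc i).comp_aestronglyMeasurable hVm.aestronglyMeasurable)
      fun ω => PiLp.norm_apply_le (V ω) i
  have hζi : ∀ i : Fin m, AllMoments (fun ω => ζ ω i) P := fun i =>
    hζ.allMoments.mono ((hc i).comp_aestronglyMeasurable hζ.allMoments.aestronglyMeasurable)
      fun ω => PiLp.norm_apply_le (ζ ω) i
  have h0 : ∀ i : Fin m, ∫ z : Vec m, z i ∂(stdGaussian (Vec m)) = 0 := fun i =>
    integral_strongDual_stdGaussian (EuclideanSpace.proj i : Vec m →L[ℝ] ℝ)
  simp only [PiLp.inner_apply, RCLike.inner_apply, conj_trivial]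
  rw [integral_finsetSum _ fun i _ => ((hζi i).mul (hVi i)).integrable]
  refine Finset.sum_eq_zero fun i _ => ?_
  simp_rw [mul_comm (ζ _ i)]
  rw [hζ.integral_mul_comp (V := fun ω => V ω i) ((hc i).measurable.comp hV) (hc i), h0, mul_zero]

end IsStdGaussianIndep

/-! ### One step of the energy recursion -/

/-- The polynomial in the size `x` of the Gaussian increment that controls the growth of a `k`-th
power over one step. -/
def incrementWeight (k : ℕ) (κ x : ℝ) : ℝ :=
  k * (κ * (1 + x ^ 2)) + k ^ 2 * (κ * (1 + x + x ^ 2)) ^ 2 * (1 + κ * (1 + x + x ^ 2)) ^ k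

/-- The mean of `incrementWeight` under the standard Gaussian law on `ℝ^m`. -/
def incrementConst (k : ℕ) (κ : ℝ) (m : ℕ) : ℝ :=
  ∫ z, incrementWeight k κ ‖z‖ ∂(stdGaussian (Vec m))

theorem incrementWeight_nonneg (k : ℕ) {κ x : ℝ} (hκ : 0 ≤ κ) (hx : 0 ≤ x) :
    0 ≤ incrementWeight k κ x := by
  unfold incrementWeight; positivity

theorem incrementConst_nonneg (k : ℕ) {κ : ℝ} (hκ : 0 ≤ κ) (m : ℕ) : 0 ≤ incrementConst k κ m :=
  integral_nonneg fun _ => incrementWeight_nonneg k hκ (norm_nonneg _)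

/-- With `s = √h`, the term of order `√h` is linear in the increment `i`, and everything else is
of order `h`. -/
theorem pow_step_le {a c i q s κ x : ℝ} (ha : 0 ≤ a) (hc : 0 ≤ c) (hκ : 0 ≤ κ) (hx : 0 ≤ x)
    (hi : |i| ≤ κ * c * x) (hq0 : 0 ≤ q) (hq : q ≤ κ * c * (1 + x ^ 2)) (hs : 0 ≤ s) (hs1 : s ≤ 1)
    (k : ℕ) :
    (a + s * i + s ^ 2 * q) ^ k
      ≤ a ^ k + s * (k * a ^ (k - 1) * i) + s ^ 2 * ((a + c) ^ k * incrementWeight k κ x) := by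
  set U := κ * (1 + x + x ^ 2) with hU
  have hU0 : 0 ≤ U := by positivity
  have hss : s ^ 2 ≤ s := by nlinarith
  have he : |s * i + s ^ 2 * q| ≤ (a + c) * (s * U) := by
    calc |s * i + s ^ 2 * q| ≤ s * |i| + s ^ 2 * q := by
          refine (abs_add_le _ _).trans_eq ?_
          rw [abs_mul, abs_of_nonneg hs, abs_of_nonneg (by positivity : 0 ≤ s ^ 2 * q)]
      _ ≤ s * (κ * c * x) + s * (κ * c * (1 + x ^ 2)) := by gcongr
      _ = c * (s * U) := by rw [hU]; ring
      _ ≤ (a + c) * (s * U) := by gcongr; linarith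
  have h1 := (abs_le.1 (abs_add_pow_sub_le (by rw [abs_of_nonneg ha]; linarith)
    (by positivity : 0 ≤ s * U) he k)).2
  have h2 : (1 + s * U) ^ k ≤ (1 + U) ^ k := by
    gcongr
    nlinarith
  have h3 : (k : ℝ) ^ 2 * (a + c) ^ k * (s * U) ^ 2 * (1 + s * U) ^ k
      ≤ s ^ 2 * ((a + c) ^ k * (k ^ 2 * U ^ 2 * (1 + U) ^ k)) := by
    calc _ ≤ (k : ℝ) ^ 2 * (a + c) ^ k * (s * U) ^ 2 * (1 + U) ^ k := by gcongr
      _ = _ := by ring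
  have h4 : (k : ℝ) * a ^ (k - 1) * (s ^ 2 * q)
      ≤ s ^ 2 * ((a + c) ^ k * (k * (κ * (1 + x ^ 2)))) := by
    rcases Nat.eq_zero_or_pos k with rfl | hk
    · simp
    · have e : (a + c) ^ k = (a + c) ^ (k - 1) * (a + c) := by
        rw [← pow_succ]; congr 1; omega
      calc (k : ℝ) * a ^ (k - 1) * (s ^ 2 * q)
          ≤ k * (a + c) ^ (k - 1) * (s ^ 2 * (κ * (a + c) * (1 + x ^ 2))) := by
            gcongr
            · linarith
            · exact hq.trans (by gcongr; linarith)
        _ = _ := by rw [e]; ring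
  have e2 : incrementWeight k κ x = k * (κ * (1 + x ^ 2)) + k ^ 2 * U ^ 2 * (1 + U) ^ k := rfl
  rw [e2, mul_add, mul_add]
  rw [← add_assoc] at h1
  linarith

/-- Over one step of length `s ^ 2` the `k`-th moment grows by a term of order `s ^ 2` only: the
linear term in the Gaussian increment has mean zero. -/
theorem integral_pow_step_le {Ω : Type*} {m : ℕ} {𝒢 : MeasurableSpace Ω} [MeasurableSpace Ω]
    {P : Measure Ω} [IsProbabilityMeasure P] {ζ H : Ω → Vec m} {a c q : Ω → ℝ} {κ s : ℝ}
    (hζ : IsStdGaussianIndep 𝒢 P ζ) (ha : Measurable[𝒢] a) (hc : Measurable[𝒢] c)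
    (hH : Measurable[𝒢] H) (ham : AllMoments a P) (hcm : AllMoments c P) (hHm : AllMoments H P)
    (hqm : AllMoments q P) (ha0 : ∀ ω, 0 ≤ a ω) (hc0 : ∀ ω, 0 ≤ c ω) (hκ : 0 ≤ κ)
    (hHc : ∀ ω, ‖H ω‖ ≤ κ * c ω) (hq0 : ∀ ω, 0 ≤ q ω)
    (hqc : ∀ ω, q ω ≤ κ * c ω * (1 + ‖ζ ω‖ ^ 2)) (hs : 0 ≤ s) (hs1 : s ≤ 1) (k : ℕ) :
    ∫ ω, (a ω + s * inner ℝ (H ω) (ζ ω) + s ^ 2 * q ω) ^ k ∂P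
      ≤ ∫ ω, a ω ^ k ∂P + s ^ 2 * (incrementConst k κ m * ∫ ω, (a ω + c ω) ^ k ∂P) := by
  have hζm := hζ.allMoments
  have hWm : AllMoments (fun ω => incrementWeight k κ ‖ζ ω‖) P := by
    unfold incrementWeight; fun_prop
  have hVm : AllMoments (fun ω => ((k : ℝ) * a ω ^ (k - 1)) • H ω) P := by fun_prop
  have hV : Measurable[𝒢] (fun ω => ((k : ℝ) * a ω ^ (k - 1)) • H ω) :=
    ((ha.pow_const _).const_mul _).smul hH
  have hA : Measurable[𝒢] (fun ω => (a ω + c ω) ^ k) := (ha.add hc).pow_const _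
  have hφ : Continuous fun z : Vec m => incrementWeight k κ ‖z‖ := by
    unfold incrementWeight; fun_prop
  have i1 : AllMoments (fun ω => inner ℝ (((k : ℝ) * a ω ^ (k - 1)) • H ω) (ζ ω)) P := by
    fun_prop
  have i2 : AllMoments (fun ω => (a ω + c ω) ^ k * incrementWeight k κ ‖ζ ω‖) P := by fun_prop
  have i3 : AllMoments (fun ω => a ω ^ k) P := by fun_prop
  have h := integral_mono (μ := P)
    (f := fun ω => (a ω + s * inner ℝ (H ω) (ζ ω) + s ^ 2 * q ω) ^ k)
    (g := fun ω => a ω ^ k + s * inner ℝ (((k : ℝ) * a ω ^ (k - 1)) • H ω) (ζ ω)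
      + s ^ 2 * ((a ω + c ω) ^ k * incrementWeight k κ ‖ζ ω‖))
    (AllMoments.integrable (by fun_prop)) (AllMoments.integrable (by fun_prop)) fun ω => by
      have := pow_step_le (ha0 ω) (hc0 ω) hκ (norm_nonneg (ζ ω)) (i := inner ℝ (H ω) (ζ ω))
        ((abs_real_inner_le_norm _ _).trans (by gcongr; exact hHc ω)) (hq0 ω) (hqc ω) hs hs1 k
      simpa only [real_inner_smul_left] using this
  rw [integral_add (i3.add ((AllMoments.const s).mul i1)).integrable
      ((AllMoments.const _).mul i2).integrable,
    integral_add i3.integrable ((AllMoments.const s).mul i1).integrable,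
    integral_const_mul, integral_const_mul, hζ.integral_inner_eq_zero hV hVm,
    hζ.integral_mul_comp hA hφ] at h
  rw [mul_comm (incrementConst k κ m)]
  simpa [incrementConst] using h

/-! ### Measurability of solutions of implicit equations -/

/-- If for each `ω` the continuous map `F ω` has exactly one zero `z ω`, and `F` is measurable in
`ω`, then `z` is measurable. -/
theorem measurable_of_unique_zero {Ω E : Type*} {mΩ : MeasurableSpace Ω} [NormedAddCommGroup E]
    [ProperSpace E] [MeasurableSpace E] [BorelSpace E] {F : Ω → E → E} {z : Ω → E}
    (hF : ∀ c, Measurable fun ω => F ω c) (hFc : ∀ ω, Continuous (F ω))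
    (hz : ∀ ω, F ω (z ω) = 0) (huniq : ∀ ω c, F ω c = 0 → c = z ω) : Measurable z := by
  have hcompact : ∀ S : Set E, IsCompact S → MeasurableSet (z ⁻¹' S) := by
    intro S hS
    obtain ⟨D, hDS, hDc, hD⟩ := hS.isSeparable.exists_countable_dense_subset
    have e : z ⁻¹' S = ⋂ n : ℕ, ⋃ c ∈ D, {ω | ‖F ω c‖ < 1 / ((n : ℝ) + 1)} := by
      ext ω
      simp only [mem_preimage, mem_iInter, mem_iUnion, mem_ofPred_eq, exists_prop]
      constructor
      · intro h n
        have hopen : IsOpen {c | ‖F ω c‖ < 1 / ((n : ℝ) + 1)} :=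
          isOpen_lt (hFc ω).norm continuous_const
        obtain ⟨c, hc1, hc2⟩ := mem_closure_iff.1 (hD h) _ hopen (by
          simp only [mem_ofPred_eq, hz, norm_zero]; positivity)
        exact ⟨c, hc2, hc1⟩
      · intro h
        obtain ⟨c₀, hc₀, -⟩ := h 0
        obtain ⟨c, hcS, hc⟩ := hS.exists_isMinOn ⟨c₀, hDS hc₀⟩ (hFc ω).norm.continuousOn
        have h0 : ‖F ω c‖ ≤ 0 := by
          refine le_of_forall_pos_lt_add fun ε hε => ?_
          obtain ⟨n, hn⟩ := exists_nat_one_div_lt hε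
          obtain ⟨c', hc', hlt⟩ := h n
          have := isMinOn_iff.1 hc c' (hDS hc')
          linarith
        rw [← huniq ω c (norm_le_zero_iff.1 h0)]
        exact hcS
    rw [e]
    exact MeasurableSet.iInter fun n => MeasurableSet.biUnion hDc fun c _ =>
      measurableSet_lt (hF c).norm measurable_const
  refine measurable_of_isClosed fun C hC => ?_
  have e : z ⁻¹' C = ⋃ n : ℕ, z ⁻¹' (C ∩ Metric.closedBall 0 n) := by
    rw [← preimage_iUnion, ← inter_iUnion, Metric.iUnion_closedBall_nat, inter_univ]
  rw [e]
  exact MeasurableSet.iUnion fun n =>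
    hcompact _ ((isCompact_closedBall _ _).inter_left hC)

/-! ### A discrete Gronwall inequality -/

/-- A Gronwall inequality for two interlaced sequences, each controlled by the past maximum of
both. -/
theorem interlaced_gronwall {u β : ℕ → ℝ} {C V₀ : ℝ} (hC : 0 ≤ C) (hV₀ : 0 ≤ V₀) (hu : u 0 ≤ V₀)
    (hβ : ∀ n V, V₀ ≤ V → u n ≤ V → (∀ j < n, β j ≤ V) → β n ≤ (1 + C) * V)
    (hstep : ∀ n V, V₀ ≤ V → u n ≤ V → (∀ j ≤ n, β j ≤ V) → u (n + 1) ≤ (1 + C) * V) (n : ℕ) :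
    u n ≤ (1 + C) ^ (2 * n) * V₀ ∧ ∀ j < n, β j ≤ (1 + C) ^ (2 * n) * V₀ := by
  have hge : ∀ l, V₀ ≤ (1 + C) ^ l * V₀ := fun l =>
    le_mul_of_one_le_left hV₀ (one_le_pow₀ (by linarith))
  have hup : ∀ l, (1 + C) ^ l * V₀ ≤ (1 + C) ^ (l + 1) * V₀ := fun l => by
    gcongr
    · linarith
    · omega
  have hs : ∀ l, (1 + C) * ((1 + C) ^ l * V₀) = (1 + C) ^ (l + 1) * V₀ := fun l => by ring
  induction n with
  | zero => simpa using hu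
  | succ n ih =>
    have hb : ∀ j ≤ n, β j ≤ (1 + C) ^ (2 * n + 1) * V₀ := by
      intro j hj
      rcases hj.lt_or_eq with h | rfl
      · exact (ih.2 j h).trans (hup _)
      · rw [← hs]; exact hβ _ _ (hge _) ih.1 ih.2
    refine ⟨?_, fun j hj => (hb j (by omega)).trans (hup _)⟩
    have := hstep n _ (hge _) (ih.1.trans (hup _)) hb
    rwa [hs] at this

/-! ### Moments of the energy recursion -/

/-- The scalar recursion behind the split-step scheme. Here `X n` dominates the squared norm of
the `n`-th value, `b n` is the squared norm of the `n`-th stage, and `c n` controls the size of the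
coefficients on step `n`; `ρ n` is the contribution of the initial path to the memory, and `J n`
is the set of earlier stages that enter the memory. -/
structure IsEnergyScheme {Ω : Type*} {m : ℕ} (𝒢 : ℕ → MeasurableSpace Ω) [mΩ : MeasurableSpace Ω]
    (P : Measure Ω) (κ h : ℝ) (ζ : ℕ → Ω → Vec m) (X b c ρ q : ℕ → Ω → ℝ) (H : ℕ → Ω → Vec m)
    (J : ℕ → Finset ℕ) : Prop where
  mono : Monotone 𝒢
  gauss : ∀ n, IsStdGaussianIndep (𝒢 n) P (ζ n)
  meas_X : ∀ n, Measurable[𝒢 n] (X n)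
  meas_c : ∀ n, Measurable[𝒢 n] (c n)
  meas_H : ∀ n, Measurable[𝒢 n] (H n)
  moments_X : ∀ n, AllMoments (X n) P
  moments_b : ∀ n, AllMoments (b n) P
  moments_c : ∀ n, AllMoments (c n) P
  moments_ρ : ∀ n, AllMoments (ρ n) P
  moments_q : ∀ n, AllMoments (q n) P
  moments_H : ∀ n, AllMoments (H n) P
  X_nonneg : ∀ n ω, 0 ≤ X n ω
  b_nonneg : ∀ n ω, 0 ≤ b n ω
  c_nonneg : ∀ n ω, 0 ≤ c n ω
  ρ_nonneg : ∀ n ω, 0 ≤ ρ n ω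
  q_nonneg : ∀ n ω, 0 ≤ q n ω
  norm_H_le : ∀ n ω, ‖H n ω‖ ≤ 2 * κ * c n ω
  q_le : ∀ n ω, q n ω ≤ 2 * κ * c n ω * (1 + ‖ζ n ω‖ ^ 2)
  X_succ : ∀ n ω, X (n + 1) ω = X n ω + √h * inner ℝ (H n ω) (ζ n ω) + √h ^ 2 * q n ω
  b_le : ∀ n ω, b n ω ≤ X n ω + h * (2 * κ * c n ω)
  c_le : ∀ n ω, c n ω ≤ 1 + 2 * b n ω + ρ n ω + ∑ j ∈ J n, b j ω
  J_lt : ∀ n, ∀ j ∈ J n, j < n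
  J_card : ∀ n, (J n).card ≤ 2

/-- The factor by which the `k`-th moment of `X + 1 + ρ + ∑ b` may exceed a common bound of the
`k`-th moments of the terms. -/
def sumConst (k : ℕ) : ℝ := 2 ^ k * (1 + 2 ^ k * (1 + 2 ^ k * (1 + 2 ^ k * 2)))

/-- The growth rate of the `k`-th moments of the energy recursion. -/
def growthRate (k : ℕ) (κ : ℝ) (m : ℕ) : ℝ :=
  (9 * κ) ^ k * sumConst k + incrementConst k (2 * κ) m * (2 ^ k * (2 ^ k * (1 + sumConst k)))

theorem sumConst_nonneg (k : ℕ) : 0 ≤ sumConst k := by unfold sumConst; positivity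

theorem growthRate_nonneg (k : ℕ) {κ : ℝ} (hκ : 0 ≤ κ) (m : ℕ) : 0 ≤ growthRate k κ m := by
  have := sumConst_nonneg k
  have := incrementConst_nonneg k (κ := 2 * κ) (by positivity) m
  unfold growthRate
  positivity

theorem sum_pow_le_of_card_le_two {ι : Type*} {s : Finset ι} (hs : s.card ≤ 2) {f : ι → ℝ}
    (hf : ∀ i ∈ s, 0 ≤ f i) {k : ℕ} (hk : k ≠ 0) :
    (∑ i ∈ s, f i) ^ k ≤ 2 ^ k * ∑ i ∈ s, f i ^ k := by
  obtain ⟨k, rfl⟩ := Nat.exists_eq_succ_of_ne_zero hk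
  rcases s.eq_empty_or_nonempty with rfl | hne
  · simp
  have h := pow_sum_div_card_le_sum_pow hf k
  have hc : (0 : ℝ) < s.card := by exact_mod_cast hne.card_pos
  rw [div_le_iff₀ (by positivity)] at h
  have h2 : (s.card : ℝ) ≤ 2 := by exact_mod_cast hs
  have hS : 0 ≤ ∑ i ∈ s, f i ^ (k + 1) := Finset.sum_nonneg fun i hi => pow_nonneg (hf i hi) _
  calc (∑ i ∈ s, f i) ^ (k + 1) ≤ (∑ i ∈ s, f i ^ (k + 1)) * (s.card : ℝ) ^ k := h
    _ ≤ (∑ i ∈ s, f i ^ (k + 1)) * 2 ^ (k + 1) := by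
        gcongr
        calc (s.card : ℝ) ^ k ≤ 2 ^ k := by gcongr
          _ ≤ 2 ^ (k + 1) := by gcongr <;> norm_num
    _ = _ := mul_comm _ _

theorem integral_add_pow_le {Ω : Type*} [MeasurableSpace Ω] {P : Measure Ω}
    [IsProbabilityMeasure P] {X Y : Ω → ℝ} (hX : AllMoments X P) (hY : AllMoments Y P)
    (hX0 : ∀ ω, 0 ≤ X ω) (hY0 : ∀ ω, 0 ≤ Y ω) (k : ℕ) :
    ∫ ω, (X ω + Y ω) ^ k ∂P ≤ 2 ^ k * (∫ ω, X ω ^ k ∂P + ∫ ω, Y ω ^ k ∂P) := by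
  rw [← integral_add (hX.pow k).integrable (hY.pow k).integrable, ← integral_const_mul]
  exact integral_mono ((hX.add hY).pow k).integrable
    ((AllMoments.const _).mul ((hX.pow k).add (hY.pow k))).integrable
    fun ω => add_pow_le_two_pow (hX0 ω) (hY0 ω) k

/-- A bound for the `k`-th moments of the energy recursion up to time `T`, when those of the initial
path are at most `Ψ`. -/
def momentBound (k : ℕ) (κ : ℝ) (m : ℕ) (T Ψ : ℝ) : ℝ :=
  2 ^ k * (2 ^ k * (1 + sumConst k)) * (Real.exp (growthRate k κ m * (2 * T + 2)) * (1 + Ψ))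

namespace IsEnergyScheme

variable {Ω : Type*} {m : ℕ} {𝒢 : ℕ → MeasurableSpace Ω} [mΩ : MeasurableSpace Ω]
  {P : Measure Ω} {κ h : ℝ} {ζ : ℕ → Ω → Vec m}
  {X b c ρ q : ℕ → Ω → ℝ} {H : ℕ → Ω → Vec m} {J : ℕ → Finset ℕ}

theorem sum_nonneg (S : IsEnergyScheme 𝒢 P κ h ζ X b c ρ q H J) (n : ℕ) (ω : Ω) :
    0 ≤ ∑ j ∈ J n, b j ω := Finset.sum_nonneg fun j _ => S.b_nonneg j ω

theorem moments_sum (S : IsEnergyScheme 𝒢 P κ h ζ X b c ρ q H J) (n : ℕ) :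
    AllMoments (fun ω => ∑ j ∈ J n, b j ω) P :=
  AllMoments.finset_sum _ fun j _ => S.moments_b j

/-- Since the stage `b n` enters the right-hand side with a factor
of order `h`, it can be absorbed in the left-hand side. The
threshold for `h` does not involve the order of the moments considered later. -/
theorem b_le_add_mul (S : IsEnergyScheme 𝒢 P κ h ζ X b c ρ q H J) (hκ : 1 ≤ κ) (h0 : 0 ≤ h)
    (hh : 8 * κ * h ≤ 1) (n : ℕ) (ω : Ω) :
    b n ω ≤ X n ω + h * (8 * κ * (X n ω + (1 + (ρ n ω + ∑ j ∈ J n, b j ω)))) := by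
  have h1 := S.b_le n ω
  have h2 := S.c_le n ω
  have hX := S.X_nonneg n ω
  have hR : 0 ≤ 1 + (ρ n ω + ∑ j ∈ J n, b j ω) := by
    have := S.ρ_nonneg n ω
    have := S.sum_nonneg n ω
    positivity
  set R := 1 + (ρ n ω + ∑ j ∈ J n, b j ω) with hRdef
  have hx : 0 ≤ h * κ := by positivity
  have h3 : b n ω * (1 - 4 * (h * κ)) ≤ X n ω + 2 * (h * κ) * R := by
    have := mul_le_mul_of_nonneg_left h2 hx
    rw [hRdef]
    nlinarith
  have h4 : X n ω + 2 * (h * κ) * R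
      ≤ (X n ω + h * (8 * κ * (X n ω + R))) * (1 - 4 * (h * κ)) := by
    have : 0 ≤ 1 - 8 * (h * κ) := by linarith
    nlinarith [mul_nonneg (mul_nonneg hx this) hX, mul_nonneg (mul_nonneg hx this) hR,
      mul_nonneg hx hX, mul_nonneg hx hR]
  exact le_of_mul_le_mul_right (h3.trans h4) (by linarith)

variable [IsProbabilityMeasure P]

theorem integral_past_pow_le (S : IsEnergyScheme 𝒢 P κ h ζ X b c ρ q H J) {k : ℕ} (hk : k ≠ 0)
    {n : ℕ} {V : ℝ} (hV : 1 ≤ V) (hρ : ∫ ω, ρ n ω ^ k ∂P ≤ V) (hX : ∫ ω, X n ω ^ k ∂P ≤ V)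
    (hb : ∀ j < n, ∫ ω, b j ω ^ k ∂P ≤ V) :
    ∫ ω, (X n ω + (1 + (ρ n ω + ∑ j ∈ J n, b j ω))) ^ k ∂P ≤ sumConst k * V := by
  have mX := S.moments_X n
  have mρ := S.moments_ρ n
  have mS := S.moments_sum n
  have hS0 := S.sum_nonneg n
  have hρ0 := S.ρ_nonneg n
  have hS : ∫ ω, (∑ j ∈ J n, b j ω) ^ k ∂P ≤ 2 ^ k * (2 * V) := by
    have mb : ∀ j, AllMoments (fun ω => b j ω ^ k) P := fun j => (S.moments_b j).pow k
    calc ∫ ω, (∑ j ∈ J n, b j ω) ^ k ∂P ≤ ∫ ω, 2 ^ k * ∑ j ∈ J n, b j ω ^ k ∂P :=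
          integral_mono (mS.pow k).integrable
            ((AllMoments.const _).mul (AllMoments.finset_sum _ fun j _ => mb j)).integrable
            fun ω => sum_pow_le_of_card_le_two (S.J_card n) (fun j _ => S.b_nonneg j ω) hk
      _ = 2 ^ k * ∑ j ∈ J n, ∫ ω, b j ω ^ k ∂P := by
          rw [integral_const_mul, integral_finsetSum _ fun j _ => (mb j).integrable]
      _ ≤ 2 ^ k * ((J n).card • V) := by
          gcongr
          exact Finset.sum_le_card_nsmul _ _ _ fun j hj => hb j (S.J_lt n j hj)
      _ ≤ 2 ^ k * (2 * V) := by
          rw [nsmul_eq_mul]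
          gcongr
          exact_mod_cast S.J_card n
  have h1 := integral_add_pow_le mρ mS hρ0 hS0 k
  have h2 := integral_add_pow_le (AllMoments.const (P := P) (1 : ℝ)) (mρ.add mS)
    (fun _ => zero_le_one) (fun ω => add_nonneg (hρ0 ω) (hS0 ω)) k
  have h3 := integral_add_pow_le mX ((AllMoments.const (P := P) (1 : ℝ)).add (mρ.add mS))
    (S.X_nonneg n) (fun ω => add_nonneg zero_le_one (add_nonneg (hρ0 ω) (hS0 ω))) k
  simp only [one_pow, integral_const, probReal_univ, one_smul] at h2
  calc _ ≤ _ := h3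
    _ ≤ 2 ^ k * (V + 2 ^ k * (V + 2 ^ k * (V + 2 ^ k * (2 * V)))) := by
        gcongr
        refine h2.trans ?_
        gcongr
        refine h1.trans ?_
        gcongr
    _ = _ := by unfold sumConst; ring

theorem integral_b_pow_le (S : IsEnergyScheme 𝒢 P κ h ζ X b c ρ q H J) (hκ : 1 ≤ κ) (h0 : 0 ≤ h)
    (hh : 8 * κ * h ≤ 1) {k : ℕ} (hk : k ≠ 0) {n : ℕ} {V : ℝ} (hV : 1 ≤ V)
    (hρ : ∫ ω, ρ n ω ^ k ∂P ≤ V) (hX : ∫ ω, X n ω ^ k ∂P ≤ V)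
    (hb : ∀ j < n, ∫ ω, b j ω ^ k ∂P ≤ V) :
    ∫ ω, b n ω ^ k ∂P ≤ (1 + h * ((9 * κ) ^ k * sumConst k)) * V := by
  have mX := S.moments_X n
  have mY : AllMoments (fun ω => X n ω + (1 + (ρ n ω + ∑ j ∈ J n, b j ω))) P :=
    mX.add ((AllMoments.const _).add ((S.moments_ρ n).add (S.moments_sum n)))
  have h1 : h ≤ 1 := by nlinarith
  have key : ∀ ω, b n ω ^ k ≤ X n ω ^ k
      + h * ((9 * κ) ^ k * (X n ω + (1 + (ρ n ω + ∑ j ∈ J n, b j ω))) ^ k) := by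
    intro ω
    have hX0 := S.X_nonneg n ω
    have hR : 0 ≤ 1 + (ρ n ω + ∑ j ∈ J n, b j ω) := by
      have := S.ρ_nonneg n ω
      have := S.sum_nonneg n ω
      positivity
    have := S.b_le_add_mul hκ h0 hh n ω
    set R := 1 + (ρ n ω + ∑ j ∈ J n, b j ω) with hRdef
    calc b n ω ^ k ≤ (X n ω + h * (8 * κ * (X n ω + R))) ^ k := by
          gcongr
          exact S.b_nonneg n ω
      _ ≤ X n ω ^ k + h * (X n ω + 8 * κ * (X n ω + R)) ^ k :=
          add_mul_pow_le hX0 (by positivity) h0 h1 k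
      _ ≤ X n ω ^ k + h * (9 * κ * (X n ω + R)) ^ k := by
          gcongr
          nlinarith
      _ = _ := by rw [mul_pow]
  calc ∫ ω, b n ω ^ k ∂P ≤ ∫ ω, (X n ω ^ k
      + h * ((9 * κ) ^ k * (X n ω + (1 + (ρ n ω + ∑ j ∈ J n, b j ω))) ^ k)) ∂P :=
        integral_mono ((S.moments_b n).pow k).integrable
          ((mX.pow k).add ((AllMoments.const _).mul
            ((AllMoments.const _).mul (mY.pow k)))).integrable key
    _ = ∫ ω, X n ω ^ k ∂P + h * ((9 * κ) ^ k
          * ∫ ω, (X n ω + (1 + (ρ n ω + ∑ j ∈ J n, b j ω))) ^ k ∂P) := by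
        rw [integral_add (mX.pow k).integrable ((AllMoments.const _).mul
            ((AllMoments.const _).mul (mY.pow k))).integrable,
          integral_const_mul, integral_const_mul]
    _ ≤ V + h * ((9 * κ) ^ k * (sumConst k * V)) := by
        gcongr
        exact S.integral_past_pow_le hk hV hρ hX hb
    _ = _ := by ring

theorem integral_X_add_c_pow_le (S : IsEnergyScheme 𝒢 P κ h ζ X b c ρ q H J) {k : ℕ} (hk : k ≠ 0)
    {n : ℕ} {V : ℝ} (hV : 1 ≤ V) (hρ : ∫ ω, ρ n ω ^ k ∂P ≤ V) (hX : ∫ ω, X n ω ^ k ∂P ≤ V)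
    (hb : ∀ j ≤ n, ∫ ω, b j ω ^ k ∂P ≤ V) :
    ∫ ω, (X n ω + c n ω) ^ k ∂P ≤ 2 ^ k * (2 ^ k * (1 + sumConst k)) * V := by
  have mb := S.moments_b n
  have mY : AllMoments (fun ω => X n ω + (1 + (ρ n ω + ∑ j ∈ J n, b j ω))) P :=
    (S.moments_X n).add ((AllMoments.const _).add ((S.moments_ρ n).add (S.moments_sum n)))
  have hY0 : ∀ ω, 0 ≤ X n ω + (1 + (ρ n ω + ∑ j ∈ J n, b j ω)) := fun ω => by
    have := S.X_nonneg n ω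
    have := S.ρ_nonneg n ω
    have := S.sum_nonneg n ω
    positivity
  calc ∫ ω, (X n ω + c n ω) ^ k ∂P
      ≤ ∫ ω, 2 ^ k * (b n ω + (X n ω + (1 + (ρ n ω + ∑ j ∈ J n, b j ω)))) ^ k ∂P := by
        refine integral_mono (((S.moments_X n).add (S.moments_c n)).pow k).integrable
          ((AllMoments.const _).mul ((mb.add mY).pow k)).integrable fun ω => ?_
        have hX0 := S.X_nonneg n ω
        have hc0 := S.c_nonneg n ω
        have := S.ρ_nonneg n ω
        have := S.sum_nonneg n ω
        have := S.c_le n ω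
        simp only [← mul_pow]
        gcongr
        linarith
    _ = 2 ^ k * ∫ ω, (b n ω + (X n ω + (1 + (ρ n ω + ∑ j ∈ J n, b j ω)))) ^ k ∂P :=
        integral_const_mul _ _
    _ ≤ 2 ^ k * (2 ^ k * (∫ ω, b n ω ^ k ∂P
          + ∫ ω, (X n ω + (1 + (ρ n ω + ∑ j ∈ J n, b j ω))) ^ k ∂P)) := by
        gcongr
        exact integral_add_pow_le mb mY (S.b_nonneg n) hY0 k
    _ ≤ 2 ^ k * (2 ^ k * (V + sumConst k * V)) := by
        gcongr
        · exact hb n le_rfl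
        · exact S.integral_past_pow_le hk hV hρ hX fun j hj => hb j hj.le
    _ = _ := by ring

theorem integral_X_succ_pow_le (S : IsEnergyScheme 𝒢 P κ h ζ X b c ρ q H J) (hκ : 1 ≤ κ)
    (h0 : 0 ≤ h) (hh : 8 * κ * h ≤ 1) {k : ℕ} (hk : k ≠ 0)
    {n : ℕ} {V : ℝ} (hV : 1 ≤ V) (hρ : ∫ ω, ρ n ω ^ k ∂P ≤ V) (hX : ∫ ω, X n ω ^ k ∂P ≤ V)
    (hb : ∀ j ≤ n, ∫ ω, b j ω ^ k ∂P ≤ V) :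
    ∫ ω, X (n + 1) ω ^ k ∂P
      ≤ (1 + h * (incrementConst k (2 * κ) m * (2 ^ k * (2 ^ k * (1 + sumConst k))))) * V := by
  have h1 : h ≤ 1 := by nlinarith
  have hI := incrementConst_nonneg k (κ := 2 * κ) (by positivity) m
  simp_rw [S.X_succ]
  refine (integral_pow_step_le (S.gauss n) (S.meas_X n) (S.meas_c n) (S.meas_H n)
    (S.moments_X n) (S.moments_c n) (S.moments_H n) (S.moments_q n) (S.X_nonneg n) (S.c_nonneg n)
    (κ := 2 * κ) (by positivity) (S.norm_H_le n) (S.q_nonneg n) (S.q_le n) (Real.sqrt_nonneg h)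
    (Real.sqrt_le_one.2 h1) k).trans ?_
  rw [Real.sq_sqrt h0]
  calc _ ≤ V + h * (incrementConst k (2 * κ) m
          * (2 ^ k * (2 ^ k * (1 + sumConst k)) * V)) := by
        gcongr
        exact S.integral_X_add_c_pow_le hk hV hρ hX hb
    _ = _ := by ring

/-- The moments of the energy recursion on `[0, T]` are bounded uniformly in the step size. -/
theorem integral_pow_le (S : IsEnergyScheme 𝒢 P κ h ζ X b c ρ q H J) (hκ : 1 ≤ κ)
    (h0 : 0 ≤ h) (hh : 8 * κ * h ≤ 1) {k : ℕ} (hk : k ≠ 0) {Ψ T : ℝ}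
    (hρ : ∀ n, ∫ ω, ρ n ω ^ k ∂P ≤ Ψ) (hX : ∫ ω, X 0 ω ^ k ∂P ≤ Ψ) {n : ℕ} (hn : n * h ≤ T) :
    ∫ ω, (X n ω + c n ω) ^ k ∂P ≤ momentBound k κ m T Ψ := by
  have hΨ : 0 ≤ Ψ := (integral_nonneg fun ω => pow_nonneg (S.X_nonneg 0 ω) k).trans hX
  have hG := growthRate_nonneg k (κ := κ) (by positivity) m
  have hs := sumConst_nonneg k
  have hI := incrementConst_nonneg k (κ := 2 * κ) (by positivity) m
  have h1 : h ≤ 1 := by nlinarith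
  have g1 : h * ((9 * κ) ^ k * sumConst k) ≤ h * growthRate k κ m := by
    gcongr
    exact le_add_of_nonneg_right (by positivity)
  have g2 : h * (incrementConst k (2 * κ) m * (2 ^ k * (2 ^ k * (1 + sumConst k))))
      ≤ h * growthRate k κ m := by
    gcongr
    exact le_add_of_nonneg_left (by positivity)
  have gr := interlaced_gronwall (u := fun n => ∫ ω, X n ω ^ k ∂P)
    (β := fun n => ∫ ω, b n ω ^ k ∂P) (C := h * growthRate k κ m) (V₀ := 1 + Ψ)
    (by positivity) (by positivity) (by linarith)
    (fun n V hV hu hb => (S.integral_b_pow_le hκ h0 hh hk (by linarith)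
      ((hρ n).trans (by linarith)) hu hb).trans (by
        have : 0 ≤ V := by linarith
        gcongr))
    (fun n V hV hu hb => (S.integral_X_succ_pow_le hκ h0 hh hk (by linarith)
      ((hρ n).trans (by linarith)) hu hb).trans (by
        have : 0 ≤ V := by linarith
        gcongr))
  set V := (1 + h * growthRate k κ m) ^ (2 * (n + 1)) * (1 + Ψ) with hVdef
  have hVle : (1 + h * growthRate k κ m) ^ (2 * n) * (1 + Ψ) ≤ V := by
    rw [hVdef]
    gcongr
    · exact le_add_of_nonneg_right (by positivity)
    · omega
  have hV1 : 1 + Ψ ≤ V :=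
    le_mul_of_one_le_left (by positivity) (one_le_pow₀ (le_add_of_nonneg_right (by positivity)))
  have hVexp : V ≤ Real.exp (growthRate k κ m * (2 * T + 2)) * (1 + Ψ) := by
    rw [hVdef]
    gcongr
    calc (1 + h * growthRate k κ m) ^ (2 * (n + 1))
        ≤ Real.exp (h * growthRate k κ m) ^ (2 * (n + 1)) := by
          gcongr
          linarith [Real.add_one_le_exp (h * growthRate k κ m)]
      _ = Real.exp (growthRate k κ m * (2 * (n * h) + 2 * h)) := by
          rw [← Real.exp_nat_mul]
          congr 1
          push_cast
          ring
      _ ≤ _ := by gcongr; linarith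
  refine (S.integral_X_add_c_pow_le hk (by linarith) ((hρ n).trans (by linarith))
    ((gr n).1.trans hVle) fun j hj => (gr (n + 1)).2 j (by omega)).trans ?_
  unfold momentBound
  gcongr

/-- The moments of the maximum of the energy over the grid are controlled by the moments at the
final time: the `k`-th power of the energy is a nonnegative submartingale, so Doob's inequality
applies. -/
theorem integral_partialSups_pow_sq_le (S : IsEnergyScheme 𝒢 P κ h ζ X b c ρ q H J) (k n : ℕ) :
    ∫ ω, (partialSups (fun i => X i ω ^ k) n) ^ 2 ∂P ≤ 4 * ∫ ω, X n ω ^ (2 * k) ∂P := by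
  have mX : ∀ i, AllMoments (fun ω => X i ω ^ k) P := fun i => (S.moments_X i).pow k
  have meas : ∀ n, Measurable[𝒢 n] fun ω => partialSups (fun i => X i ω ^ k) n := by
    intro n
    induction n with
    | zero => simpa using (S.meas_X 0).pow_const k
    | succ n ih =>
      simp only [partialSups_add_one]
      exact (ih.mono (S.mono n.le_succ) le_rfl).sup ((S.meas_X (n + 1)).pow_const k)
  have := integral_partialSups_sq_le (x := fun i ω => X i ω ^ k) mX (fun n => ?_) n
  · simpa only [← pow_mul, mul_comm k 2] using this
  · have mS := AllMoments.partialSups mX n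
    have mH := S.moments_H n
    have mXn := S.moments_X n
    have mζ := (S.gauss n).allMoments
    have hV : Measurable[𝒢 n] fun ω => (partialSups (fun i => X i ω ^ k) n
        * (√h * (k * X n ω ^ (k - 1)))) • H n ω :=
      ((meas n).mul ((((S.meas_X n).pow_const _).const_mul _).const_mul _)).smul (S.meas_H n)
    have mV : AllMoments (fun ω => (partialSups (fun i => X i ω ^ k) n
        * (√h * (k * X n ω ^ (k - 1)))) • H n ω) P := by fun_prop
    rw [← (S.gauss n).integral_inner_eq_zero hV mV]
    refine integral_mono (mV.inner mζ).integrable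
      (mS.mul ((mX (n + 1)).sub (mX n))).integrable fun ω => ?_
    have hX0 := S.X_nonneg n ω
    have h1 := mul_pow_mul_sub_le (S.X_nonneg (n + 1) ω) hX0 k
    have h2 : 0 ≤ partialSups (fun i => X i ω ^ k) n :=
      (pow_nonneg hX0 k).trans (le_partialSups (fun i => X i ω ^ k) n)
    have h3 : 0 ≤ (k : ℝ) * X n ω ^ (k - 1) * (√h ^ 2 * q n ω) := by
      have := S.q_nonneg n ω
      positivity
    have h4 := S.X_succ n ω
    simp only [real_inner_smul_left, mul_assoc]
    refine mul_le_mul_of_nonneg_left (le_trans ?_ h1) h2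
    rw [h4]
    linarith

end IsEnergyScheme

/-! ### Increments of the Wiener process -/

/-- The increment of `w` over `[s, t]`, normalised to have unit covariance. -/
def normIncr {Ω : Type*} {m : ℕ} (w : ℝ≥0 → Ω → Vec m) (s t : ℝ) (ω : Ω) : Vec m :=
  (√(t - s))⁻¹ • (w t.toNNReal ω - w s.toNNReal ω)

theorem sqrt_smul_normIncr {Ω : Type*} {m : ℕ} (w : ℝ≥0 → Ω → Vec m) {s t : ℝ} (h : s < t)
    (ω : Ω) : √(t - s) • normIncr w s t ω = w t.toNNReal ω - w s.toNNReal ω :=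
  smul_inv_smul₀ (Real.sqrt_pos.2 (sub_pos.2 h)).ne' _

namespace IsWiener

variable {Ω : Type*} [mΩ : MeasurableSpace Ω] {m : ℕ} {P : Measure Ω}
  {ℱ : Filtration ℝ≥0 (inferInstance : MeasurableSpace Ω)} {w : ℝ≥0 → Ω → Vec m}

theorem isStdGaussianIndep_normIncr (hw : IsWiener P ℱ w) {s t : ℝ} (hs : 0 ≤ s) (h : s < t) :
    IsStdGaussianIndep (ℱ s.toNNReal) P (normIncr w s t) := by
  have hst : s.toNNReal ≤ t.toNNReal := Real.toNNReal_le_toNNReal h.le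
  have hm : ∀ t, Measurable (w t) := fun t => (hw.adapted t).mono (ℱ.le t) le_rfl
  have hd : Measurable fun ω => w t.toNNReal ω - w s.toNNReal ω := (hm _).sub (hm _)
  have hpos : 0 < √(t - s) := Real.sqrt_pos.2 (sub_pos.2 h)
  refine ⟨ℱ.le _, hd.const_smul (√(t - s))⁻¹, ?_, ?_⟩
  · have e : normIncr w s t
        = (fun v : Vec m => (√(t - s))⁻¹ • v) ∘ fun ω => w t.toNNReal ω - w s.toNNReal ω := rfl
    have hl := (hw.law _ _ hst).map_eq
    rw [Real.coe_toNNReal _ hs, Real.coe_toNNReal _ (hs.trans h.le)] at hl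
    rw [e, ← Measure.map_map (measurable_const_smul _) hd, hl,
      Measure.map_map (measurable_const_smul _) (measurable_const_smul _)]
    convert Measure.map_id
    ext1 v
    simp [inv_smul_smul₀ hpos.ne']
  · refine indep_of_indep_of_le_left (hw.indep _ _ hst) ?_
    refine Measurable.comap_le ?_
    exact (comap_measurable fun ω => w t.toNNReal ω - w s.toNNReal ω).const_smul (√(t - s))⁻¹

/-- Doob's inequality for the Wiener process along a uniform grid of `[s, s + l δ]`. -/
theorem lintegral_partialSups_pow_sq_le [IsProbabilityMeasure P] (hw : IsWiener P ℱ w) {s δ : ℝ}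
    (hs : 0 ≤ s) (hδ : 0 < δ) (k : ℕ) {l : ℕ} (hl : l ≠ 0) :
    ∫⁻ ω, ENNReal.ofReal ((partialSups
        (fun i : ℕ => ‖w (s + i * δ).toNNReal ω - w s.toNNReal ω‖ ^ (2 * k)) l) ^ 2) ∂P
      ≤ ENNReal.ofReal
        (4 * ((l * δ) ^ (2 * k) * ∫ z, ‖z‖ ^ (4 * k) ∂(stdGaussian (Vec m)))) := by
  set W : ℕ → Ω → Vec m := fun i ω => w (s + i * δ).toNNReal ω - w s.toNNReal ω with hW
  have hgi : ∀ i : ℕ, IsStdGaussianIndep (ℱ (s + i * δ).toNNReal) P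
      (normIncr w (s + i * δ) (s + (i + 1 : ℕ) * δ)) := fun i =>
    hw.isStdGaussianIndep_normIncr (by positivity) (by push_cast; linarith)
  have hsucc : ∀ i ω, W (i + 1) ω
      = W i ω + √δ • normIncr w (s + i * δ) (s + (i + 1 : ℕ) * δ) ω := by
    intro i ω
    have := sqrt_smul_normIncr w (s := s + i * δ) (t := s + (i + 1 : ℕ) * δ)
      (by push_cast; linarith) ω
    rw [show s + (i + 1 : ℕ) * δ - (s + i * δ) = δ by push_cast; ring] at this
    rw [this]
    simp only [hW]
    abel
  have hWm : ∀ i, AllMoments (W i) P := by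
    intro i
    induction i with
    | zero => simpa [hW] using AllMoments.const (P := P) (0 : Vec m)
    | succ i ih =>
      have e : W (i + 1) = fun ω => W i ω
        + √δ • normIncr w (s + i * δ) (s + (i + 1 : ℕ) * δ) ω := funext (hsucc i)
      rw [e]
      exact ih.add ((AllMoments.const (√δ)).smul (hgi i).allMoments)
  have hle : ∀ {i j : ℕ}, i ≤ j → (s + i * δ).toNNReal ≤ (s + j * δ).toNNReal := by
    intro i j hij
    refine Real.toNNReal_le_toNNReal ?_
    gcongr
  have hWmeas : ∀ {i j : ℕ}, i ≤ j → Measurable[ℱ (s + j * δ).toNNReal] (W i) := by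
    intro i j hij
    refine Measurable.sub ((hw.adapted _).mono (ℱ.mono (hle hij)) le_rfl)
      ((hw.adapted _).mono (ℱ.mono ?_) le_rfl)
    exact Real.toNNReal_le_toNNReal (le_add_of_nonneg_right (by positivity))
  have mx : ∀ i, AllMoments (fun ω => ‖W i ω‖ ^ (2 * k)) P := fun i => (hWm i).norm.pow _
  have meas : ∀ {n j : ℕ}, n ≤ j → Measurable[ℱ (s + j * δ).toNNReal]
      fun ω => partialSups (fun i => ‖W i ω‖ ^ (2 * k)) n := by
    intro n j hj
    induction n with
    | zero => simpa using (measurable_norm.comp (hWmeas (Nat.zero_le j))).pow_const (2 * k)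
    | succ n ih =>
      simp only [partialSups_add_one]
      exact (ih (by omega)).sup ((measurable_norm.comp (hWmeas hj)).pow_const (2 * k))
  have doob := integral_partialSups_sq_le mx (fun n => ?_) l
  · rw [← ofReal_integral_eq_lintegral_ofReal ((AllMoments.partialSups mx l).pow 2).integrable
      (.of_forall fun ω => sq_nonneg _)]
    refine ENNReal.ofReal_le_ofReal ?_
    refine doob.trans (mul_le_mul_of_nonneg_left (le_of_eq ?_) (by norm_num))
    have hl0 : (0 : ℝ) < l := by exact_mod_cast Nat.pos_of_ne_zero hl
    have hlt : s < s + l * δ := lt_add_of_pos_right _ (by positivity)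
    have hg := hw.isStdGaussianIndep_normIncr hs hlt
    rw [← hg.integral_comp (φ := fun z => ‖z‖ ^ (4 * k)) (by fun_prop), ← integral_const_mul]
    congr 1
    ext1 ω
    rw [hW]
    simp only
    rw [← sqrt_smul_normIncr w hlt ω, norm_smul, Real.norm_of_nonneg (Real.sqrt_nonneg _),
      add_sub_cancel_left, mul_pow, mul_pow, pow_mul (√_) 2 k, Real.sq_sqrt (by positivity),
      ← pow_mul, ← pow_mul]
    congr 2 <;> ring
  · set ζ := normIncr w (s + n * δ) (s + (n + 1 : ℕ) * δ) with hζ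
    have mζ := (hgi n).allMoments
    have mW := hWm n
    have mS := AllMoments.partialSups mx n
    have hV : Measurable[ℱ (s + n * δ).toNNReal] fun ω =>
        (partialSups (fun i => ‖W i ω‖ ^ (2 * k)) n
          * (k * (‖W n ω‖ ^ 2) ^ (k - 1) * (2 * √δ))) • W n ω :=
      ((meas le_rfl).mul (((((measurable_norm.comp (hWmeas le_rfl)).pow_const 2).pow_const
        _).const_mul _).mul_const _)).smul (hWmeas le_rfl)
    have mV : AllMoments (fun ω => (partialSups (fun i => ‖W i ω‖ ^ (2 * k)) n
          * (k * (‖W n ω‖ ^ 2) ^ (k - 1) * (2 * √δ))) • W n ω) P := by fun_prop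
    rw [← (hgi n).integral_inner_eq_zero hV mV]
    refine integral_mono (mV.inner mζ).integrable
      (mS.mul ((mx (n + 1)).sub (mx n))).integrable fun ω => ?_
    have h1 := mul_pow_mul_sub_le (sq_nonneg ‖W (n + 1) ω‖) (sq_nonneg ‖W n ω‖) k
    have h2 : 0 ≤ partialSups (fun i => ‖W i ω‖ ^ (2 * k)) n :=
      (by positivity : 0 ≤ ‖W n ω‖ ^ (2 * k)).trans
        (le_partialSups (fun i => ‖W i ω‖ ^ (2 * k)) n)
    simp only [real_inner_smul_left, mul_assoc]
    refine mul_le_mul_of_nonneg_left (le_trans ?_ (h1.trans_eq (by simp only [pow_mul]))) h2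
    rw [hsucc, norm_add_sq_real, real_inner_smul_right, ← hζ]
    have h3 : 0 ≤ (k : ℝ) * (‖W n ω‖ ^ 2) ^ (k - 1) * ‖√δ • ζ ω‖ ^ 2 := by positivity
    linarith

/-- The supremum of the Wiener increment over `[s, s + h]` has moments of the order of those of a
Gaussian vector of standard deviation `√h`. The dominating function is a limit of maxima over finer
and finer grids. -/
theorem exists_lintegral_le_of_increment [IsProbabilityMeasure P] (hw : IsWiener P ℱ w) {s h : ℝ}
    (hs : 0 ≤ s) (hh : 0 < h) (k : ℕ) :
    ∃ S : Ω → ℝ≥0∞, Measurable S ∧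
      ∫⁻ ω, S ω ∂P
        ≤ ENNReal.ofReal (4 * (h ^ (2 * k) * ∫ z, ‖z‖ ^ (4 * k) ∂(stdGaussian (Vec m)))) ∧
      ∀ᵐ ω ∂P, ∀ t ∈ Icc s (s + h),
        ENNReal.ofReal (‖w t.toNNReal ω - w s.toNNReal ω‖ ^ (4 * k)) ≤ S ω := by
  set F : ℕ → Ω → ℝ := fun l ω => (partialSups (fun i : ℕ =>
    ‖w (s + i * (h / (l + 1 : ℕ))).toNNReal ω - w s.toNNReal ω‖ ^ (2 * k)) (l + 1)) ^ 2 with hF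
  have hm : ∀ t, Measurable (w t) := fun t => (hw.adapted t).mono (ℱ.le t) le_rfl
  have hps : ∀ (l n : ℕ), Measurable fun ω => partialSups (fun i : ℕ =>
      ‖w (s + i * (h / (l + 1 : ℕ))).toNNReal ω - w s.toNNReal ω‖ ^ (2 * k)) n := by
    intro l n
    induction n with
    | zero => simp
    | succ n ih =>
      simp only [partialSups_add_one]
      exact ih.sup (((hm _).sub (hm _)).norm.pow_const _)
  have hFm : ∀ l, Measurable fun ω => ENNReal.ofReal (F l ω) := fun l =>
    ((hps l (l + 1)).pow_const 2).ennreal_ofReal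
  refine ⟨fun ω => Filter.liminf (fun l => ENNReal.ofReal (F l ω)) Filter.atTop,
    Measurable.liminf hFm, ?_, ?_⟩
  · refine (lintegral_liminf_le hFm).trans ?_
    refine (Filter.liminf_le_liminf (v := fun _ => ENNReal.ofReal
      (4 * (h ^ (2 * k) * ∫ z, ‖z‖ ^ (4 * k) ∂(stdGaussian (Vec m)))))
      (.of_forall fun l => ?_)).trans_eq (Filter.liminf_const _)
    have := hw.lintegral_partialSups_pow_sq_le hs (δ := h / (l + 1 : ℕ)) (by positivity) k
      (Nat.succ_ne_zero l)
    rwa [mul_div_cancel₀ _ (by positivity)] at this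
  · filter_upwards [hw.cont] with ω hω t ht
    set a := (t - s) / h with ha
    have ha0 : 0 ≤ a := div_nonneg (sub_nonneg.2 ht.1) hh.le
    have ha1 : a ≤ 1 := (div_le_one hh).2 (by linarith [ht.2])
    have hlim : Filter.Tendsto (fun l : ℕ => s + (⌊a * (l + 1 : ℕ)⌋₊ : ℝ) * (h / (l + 1 : ℕ)))
        Filter.atTop (nhds t) := by
      have h1 := ((tendsto_nat_floor_mul_div_atTop (R := ℝ) ha0).comp
        (tendsto_natCast_atTop_atTop.comp (Filter.tendsto_add_atTop_nat 1))).mul_const h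
      have h2 := h1.const_add s
      rw [show s + a * h = t by rw [ha, div_mul_cancel₀ _ hh.ne']; ring] at h2
      refine h2.congr fun l => ?_
      simp only [Function.comp_apply]
      ring
    have hcont : Continuous fun u : ℝ =>
        ENNReal.ofReal (‖w u.toNNReal ω - w s.toNNReal ω‖ ^ (4 * k)) :=
      ENNReal.continuous_ofReal.comp
        (((hω.comp continuous_real_toNNReal).sub continuous_const).norm.pow _)
    rw [← ((hcont.tendsto t).comp hlim).liminf_eq]
    refine Filter.liminf_le_liminf (.of_forall fun l => ENNReal.ofReal_le_ofReal ?_)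
    have hfl : ⌊a * (l + 1 : ℕ)⌋₊ ≤ l + 1 :=
      Nat.floor_le_of_le (mul_le_of_le_one_left (by positivity) ha1)
    have h1 := le_partialSups_of_le (fun i : ℕ =>
      ‖w (s + i * (h / (l + 1 : ℕ))).toNNReal ω - w s.toNNReal ω‖ ^ (2 * k)) hfl
    calc _ = (‖w (s + (⌊a * (l + 1 : ℕ)⌋₊ : ℝ) * (h / (l + 1 : ℕ))).toNNReal ω
            - w s.toNNReal ω‖ ^ (2 * k)) ^ 2 := by rw [← pow_mul]; congr 1; ring
      _ ≤ F l ω := by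
        simp only [hF]
        gcongr

end IsWiener

/-! ### Matrix and memory estimates along one path -/

theorem norm_applyMat_sq_le {d m : ℕ} (A : Matrix (Fin d) (Fin m) ℝ) (v : Vec m) :
    ‖applyMat A v‖ ^ 2 ≤ frobSq A * ‖v‖ ^ 2 := by
  rw [EuclideanSpace.real_norm_sq_eq, EuclideanSpace.real_norm_sq_eq, frobSq, Finset.sum_mul]
  refine Finset.sum_le_sum fun i _ => ?_
  exact Finset.sum_mul_sq_le_sq_mul_sq Finset.univ (fun j => A i j) fun j => v j

theorem inner_applyMat {d m : ℕ} (A : Matrix (Fin d) (Fin m) ℝ) (x : Vec d) (v : Vec m) :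
    inner ℝ x (applyMat A v) = inner ℝ (applyMat A.transpose x) v := by
  simp only [EuclideanSpace.inner_eq_star_dotProduct, applyMat, star_trivial]
  rw [Matrix.mulVec_transpose, dotProduct_comm, Matrix.dotProduct_mulVec, dotProduct_comm]

theorem applyMat_smul {d m : ℕ} (A : Matrix (Fin d) (Fin m) ℝ) (a : ℝ) (v : Vec m) :
    applyMat A (a • v) = a • applyMat A v := by
  simp [applyMat, Matrix.mulVec_smul]

theorem frobSq_transpose {d m : ℕ} (A : Matrix (Fin d) (Fin m) ℝ) :
    frobSq A.transpose = frobSq A := Finset.sum_comm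

theorem continuous_applyMat {d m : ℕ} :
    Continuous fun p : Matrix (Fin d) (Fin m) ℝ × Vec m => applyMat p.1 p.2 :=
  (PiLp.continuous_toLp 2 _).comp
    (continuous_fst.matrix_mulVec ((PiLp.continuous_ofLp 2 _).comp continuous_snd))

/-- The stages before step `n` that enter the memory value of step `n`. -/
def memoryIndices (h : ℝ) (τ : ℝ → ℝ) (n : ℕ) : Finset ℕ :=
  if n * h - τ (n * h) < 0 ∨ delaySteps h τ n = 0 then ∅
  else Finset.filter (· < n) {n - delaySteps h τ n + 1, n - delaySteps h τ n}

/-- The squared norm of the value of the initial path that enters the memory value of step `n`. -/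
def initialPart {d : ℕ} (h : ℝ) (τ : ℝ → ℝ) (ψ : ℝ → Vec d) (n : ℕ) : ℝ :=
  if n * h - τ (n * h) < 0 then ‖ψ (n * h - τ (n * h))‖ ^ 2 else 0

theorem initialPart_nonneg {d : ℕ} (h : ℝ) (τ : ℝ → ℝ) (ψ : ℝ → Vec d) (n : ℕ) :
    0 ≤ initialPart h τ ψ n := by
  unfold initialPart; split_ifs <;> positivity

theorem lt_of_mem_memoryIndices {h : ℝ} {τ : ℝ → ℝ} {n j : ℕ} (hj : j ∈ memoryIndices h τ n) :
    j < n := by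
  unfold memoryIndices at hj
  split_ifs at hj
  · simp at hj
  · exact (Finset.mem_filter.1 hj).2

theorem card_memoryIndices_le (h : ℝ) (τ : ℝ → ℝ) (n : ℕ) : (memoryIndices h τ n).card ≤ 2 := by
  unfold memoryIndices
  split_ifs
  · simp
  · exact (Finset.card_filter_le _ _).trans Finset.card_le_two

theorem norm_memory_sq_le {d : ℕ} (h : ℝ) (τ : ℝ → ℝ) {μ : ℕ → ℝ} (ψ : ℝ → Vec d)
    (z : ℕ → Vec d) {n : ℕ} (hμ : 0 ≤ μ n ∧ μ n < 1) :
    ‖memory h τ μ ψ z n‖ ^ 2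
      ≤ ‖z n‖ ^ 2 + initialPart h τ ψ n + ∑ j ∈ memoryIndices h τ n, ‖z j‖ ^ 2 := by
  unfold memory initialPart memoryIndices
  by_cases h1 : n * h - τ (n * h) < 0
  · simp [h1]
  by_cases h2 : delaySteps h τ n = 0
  · simp [h1, h2]
  simp only [h1, h2, if_false, or_self, add_zero]
  set i := n - delaySteps h τ n with hi
  have hin : i < n := by
    have : delaySteps h τ n ≤ n := Nat.sub_le _ _
    omega
  have hconv : ‖μ n • z (i + 1) + (1 - μ n) • z i‖ ^ 2 ≤ ‖z (i + 1)‖ ^ 2 + ‖z i‖ ^ 2 := by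
    have h3 : ‖μ n • z (i + 1) + (1 - μ n) • z i‖ ≤ μ n * ‖z (i + 1)‖ + (1 - μ n) * ‖z i‖ := by
      refine (norm_add_le _ _).trans_eq ?_
      rw [norm_smul, norm_smul, Real.norm_of_nonneg hμ.1,
        Real.norm_of_nonneg (by linarith [hμ.2])]
    have h4 : 0 ≤ 1 - μ n := by linarith [hμ.2]
    have h5 : μ n ≤ 1 := hμ.2.le
    calc _ ≤ (μ n * ‖z (i + 1)‖ + (1 - μ n) * ‖z i‖) ^ 2 := by gcongr
      _ ≤ μ n * ‖z (i + 1)‖ ^ 2 + (1 - μ n) * ‖z i‖ ^ 2 := by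
        nlinarith [mul_nonneg (mul_nonneg hμ.1 h4) (sq_nonneg (‖z (i + 1)‖ - ‖z i‖))]
      _ ≤ 1 * ‖z (i + 1)‖ ^ 2 + 1 * ‖z i‖ ^ 2 := by
        gcongr
        linarith [hμ.1]
      _ = _ := by ring
  refine hconv.trans ?_
  rcases Nat.lt_or_ge (i + 1) n with h3 | h3
  · have e : ({i + 1, i} : Finset ℕ).filter (· < n) = {i + 1, i} := by
      refine Finset.filter_true_of_mem fun j hj => ?_
      simp only [Finset.mem_insert, Finset.mem_singleton] at hj
      omega
    rw [e, Finset.sum_pair (by omega)]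
    exact le_add_of_nonneg_left (sq_nonneg _)
  · have e : i + 1 = n := by omega
    have hs : ‖z i‖ ^ 2 ≤ ∑ j ∈ ({i + 1, i} : Finset ℕ).filter (· < n), ‖z j‖ ^ 2 :=
      Finset.single_le_sum (f := fun j => ‖z j‖ ^ 2) (fun j _ => sq_nonneg _)
        (Finset.mem_filter.2 ⟨by simp, hin⟩)
    rw [← e] at hs ⊢
    linarith

/-- The implicit stage equation cannot increase the energy by more than the growth bound. -/
theorem norm_sq_le_of_stage {d : ℕ} {x z v : Vec d} {h a : ℝ} (hz : z = x + h • v) (h0 : 0 ≤ h)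
    (hv : inner ℝ z v ≤ a) : ‖z‖ ^ 2 ≤ ‖x‖ ^ 2 + h * (2 * a) := by
  have e : x = z - h • v := by rw [hz]; abel
  rw [e, norm_sub_sq_real, real_inner_smul_right]
  nlinarith [sq_nonneg ‖h • v‖, mul_le_mul_of_nonneg_left hv h0]

/-! ### Measurability of the memory -/

theorem measurable_memory {Ω : Type*} {d : ℕ} {𝒢 : MeasurableSpace Ω} {h : ℝ} {τ : ℝ → ℝ}
    {μ : ℕ → ℝ} {ψ : ℝ → Ω → Vec d} {z : ℕ → Ω → Vec d} {n : ℕ}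
    (hψ : n * h - τ (n * h) < 0 → Measurable (ψ (n * h - τ (n * h))))
    (hz : ∀ j ≤ n, Measurable (z j)) :
    Measurable fun ω => memory h τ μ (fun s => ψ s ω) (fun j => z j ω) n := by
  unfold memory
  split_ifs with h1 h2
  · exact hψ h1
  · exact hz n le_rfl
  · have : delaySteps h τ n ≤ n := Nat.sub_le _ _
    exact ((hz _ (by omega)).const_smul (μ n)).add ((hz _ (by omega)).const_smul (1 - μ n))

theorem continuous_memory_update {d : ℕ} (h : ℝ) (τ : ℝ → ℝ) (μ : ℕ → ℝ) (ψ : ℝ → Vec d)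
    (z : ℕ → Vec d) (n : ℕ) : Continuous fun c => memory h τ μ ψ (Function.update z n c) n := by
  have hu : ∀ j, Continuous fun c => Function.update z n c j := fun j =>
    (continuous_apply (A := fun _ : ℕ => Vec d) j).comp
      ((continuous_const (y := z)).update n continuous_id)
  unfold memory
  split_ifs
  · exact continuous_const
  · exact hu n
  · exact ((hu _).const_smul (μ n)).add ((hu _).const_smul (1 - μ n))

/-! ### The split-step scheme as an energy recursion -/

/-- The standing assumptions on the equation, the step size `h` and the numerical solution
`(y, z)`, where `z` stands for the stages `y*`. -/
structure IsScheme {Ω : Type*} [MeasurableSpace Ω] {d m : ℕ} (P : Measure Ω)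
    (ℱ : Filtration ℝ≥0 (inferInstance : MeasurableSpace Ω)) (w : ℝ≥0 → Ω → Vec m)
    (f : Vec d → Vec d → Vec d) (g : Vec d → Vec d → Matrix (Fin d) (Fin m) ℝ) (κ h r : ℝ)
    (τ : ℝ → ℝ) (μ : ℕ → ℝ) (ψ : ℝ → Ω → Vec d) (y z : ℕ → Ω → Vec d) : Prop where
  wiener : IsWiener P ℱ w
  cont_f : Continuous (Function.uncurry f)
  cont_g : Continuous (Function.uncurry g)
  growth : MonotoneGrowth f g κ
  one_le : 1 ≤ κ
  h_pos : 0 < h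
  h_le : 8 * κ * h ≤ 1
  weight : ∀ n, 0 ≤ μ n ∧ μ n < 1
  r_nonneg : 0 ≤ r
  delay : ∀ n : ℕ, -r ≤ n * h - τ (n * h)
  ψ_meas : ∀ s ∈ Icc (-r) 0, Measurable[ℱ 0] (ψ s)
  ψ_moments : ∀ s ∈ Icc (-r) 0, AllMoments (ψ s) P
  sol : ∀ ω, IsNumericalSolution f g h τ μ (fun s => ψ s ω) (fun t => w t ω)
    (fun n => y n ω) (fun n => z n ω)

namespace IsScheme

variable {Ω : Type*} {d m : ℕ}

/-- The memory value `ỹ*_n`. -/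
def mem (h : ℝ) (τ : ℝ → ℝ) (μ : ℕ → ℝ) (ψ : ℝ → Ω → Vec d) (z : ℕ → Ω → Vec d) (n : ℕ) (ω : Ω) :
    Vec d := memory h τ μ (fun s => ψ s ω) (fun j => z j ω) n

/-- The quantity `1 + |y*_n|² + |ỹ*_n|²` of the growth condition. -/
def size (z v : ℕ → Ω → Vec d) (n : ℕ) (ω : Ω) : ℝ := 1 + ‖z n ω‖ ^ 2 + ‖v n ω‖ ^ 2

/-- The normalised Wiener increment of step `n`. -/
def incr (h : ℝ) (w : ℝ≥0 → Ω → Vec m) (n : ℕ) : Ω → Vec m :=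
  normIncr w (n * h) ((n + 1 : ℕ) * h)

/-- The coefficient `2 gᵀ y*_n` of the martingale part of the energy. -/
def martCoeff (g : Vec d → Vec d → Matrix (Fin d) (Fin m) ℝ) (z v : ℕ → Ω → Vec d) (n : ℕ)
    (ω : Ω) : Vec m := (2 : ℝ) • applyMat (g (z n ω) (v n ω)).transpose (z n ω)

/-- The nonnegative part of the energy increment, divided by `h`. -/
def gain (g : Vec d → Vec d → Matrix (Fin d) (Fin m) ℝ) (κ : ℝ) (z v : ℕ → Ω → Vec d)
    (ζ : ℕ → Ω → Vec m) (n : ℕ) (ω : Ω) : ℝ :=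
  2 * κ * size z v n ω + ‖applyMat (g (z n ω) (v n ω)) (ζ n ω)‖ ^ 2

/-- The energy, a submartingale that dominates `|y_n|²`. -/
def energy (h : ℝ) (y : ℕ → Ω → Vec d) (ζ H : ℕ → Ω → Vec m) (q : ℕ → Ω → ℝ) (n : ℕ) (ω : Ω) : ℝ :=
  ‖y 0 ω‖ ^ 2 + ∑ j ∈ Finset.range n, (√h * inner ℝ (H j ω) (ζ j ω) + √h ^ 2 * q j ω)

theorem one_le_size (z v : ℕ → Ω → Vec d) (n : ℕ) (ω : Ω) : 1 ≤ size z v n ω := by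
  unfold size; nlinarith [sq_nonneg ‖z n ω‖, sq_nonneg ‖v n ω‖]

variable [mΩ : MeasurableSpace Ω] {P : Measure Ω}
  {ℱ : Filtration ℝ≥0 (inferInstance : MeasurableSpace Ω)} {w : ℝ≥0 → Ω → Vec m}
  {f : Vec d → Vec d → Vec d} {g : Vec d → Vec d → Matrix (Fin d) (Fin m) ℝ} {κ h r : ℝ}
  {τ : ℝ → ℝ} {μ : ℕ → ℝ} {ψ : ℝ → Ω → Vec d} {y z : ℕ → Ω → Vec d}

theorem frobSq_le (S : IsScheme P ℱ w f g κ h r τ μ ψ y z) (n : ℕ) (ω : Ω) :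
    frobSq (g (z n ω) (mem h τ μ ψ z n ω)) ≤ κ * size z (mem h τ μ ψ z) n ω :=
  (le_max_right _ _).trans (S.growth _ _)

theorem sqrt_smul_incr (S : IsScheme P ℱ w f g κ h r τ μ ψ y z) (n : ℕ) (ω : Ω) :
    √h • incr h w n ω
      = w (Real.toNNReal ((n + 1 : ℕ) * h)) ω - w (Real.toNNReal (n * h)) ω := by
  have := sqrt_smul_normIncr w (s := n * h) (t := (n + 1 : ℕ) * h)
    (by push_cast; linarith [S.h_pos]) ω
  rwa [show ((n + 1 : ℕ) : ℝ) * h - n * h = h by push_cast; ring] at this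

theorem stage_eq (S : IsScheme P ℱ w f g κ h r τ μ ψ y z) (n : ℕ) (ω : Ω) :
    z n ω = y n ω + h • f (z n ω) (mem h τ μ ψ z n ω) := (S.sol ω).stage n

theorem step_eq (S : IsScheme P ℱ w f g κ h r τ μ ψ y z) (n : ℕ) (ω : Ω) :
    y (n + 1) ω = z n ω + √h • applyMat (g (z n ω) (mem h τ μ ψ z n ω)) (incr h w n ω) := by
  rw [← applyMat_smul, S.sqrt_smul_incr]
  exact (S.sol ω).step n

theorem norm_stage_sq_le (S : IsScheme P ℱ w f g κ h r τ μ ψ y z) (n : ℕ) (ω : Ω) :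
    ‖z n ω‖ ^ 2 ≤ ‖y n ω‖ ^ 2 + h * (2 * κ * size z (mem h τ μ ψ z) n ω) := by
  rw [mul_assoc 2 κ]
  exact norm_sq_le_of_stage (S.stage_eq n ω) S.h_pos.le ((le_max_left _ _).trans (S.growth _ _))

theorem norm_applyMat_incr_sq_le (S : IsScheme P ℱ w f g κ h r τ μ ψ y z) (n : ℕ) (ω : Ω)
    (v : Vec m) : ‖applyMat (g (z n ω) (mem h τ μ ψ z n ω)) v‖ ^ 2
      ≤ κ * size z (mem h τ μ ψ z) n ω * ‖v‖ ^ 2 :=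
  (norm_applyMat_sq_le _ _).trans (by gcongr; exact S.frobSq_le n ω)

theorem size_le (S : IsScheme P ℱ w f g κ h r τ μ ψ y z) (n : ℕ) (ω : Ω) :
    size z (mem h τ μ ψ z) n ω ≤ 1 + 2 * ‖z n ω‖ ^ 2 + initialPart h τ (fun s => ψ s ω) n
      + ∑ j ∈ memoryIndices h τ n, ‖z j ω‖ ^ 2 := by
  have := norm_memory_sq_le h τ (fun s => ψ s ω) (fun j => z j ω) (S.weight n)
  unfold size mem
  linarith

theorem monotone_grid (S : IsScheme P ℱ w f g κ h r τ μ ψ y z) :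
    Monotone fun n : ℕ => (n * h).toNNReal := fun i j hij => by
  have := S.h_pos
  refine Real.toNNReal_le_toNNReal ?_
  gcongr

theorem measurable_ψ (S : IsScheme P ℱ w f g κ h r τ μ ψ y z) (n : ℕ) (t : ℝ≥0) :
    n * h - τ (n * h) < 0 → Measurable[ℱ t] (ψ (n * h - τ (n * h))) := fun hn =>
  (S.ψ_meas _ ⟨S.delay n, hn.le⟩).mono (ℱ.mono (zero_le (a := t))) le_rfl

theorem measurable_incr (S : IsScheme P ℱ w f g κ h r τ μ ψ y z) {j n : ℕ} (hj : j < n) :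
    Measurable[ℱ (n * h).toNNReal] (incr h w j) := by
  have h1 : ∀ i ≤ n, Measurable[ℱ (n * h).toNNReal] (w (i * h).toNNReal) := fun i hi =>
    (S.wiener.adapted _).mono (ℱ.mono (S.monotone_grid hi)) le_rfl
  exact ((h1 _ hj).sub (h1 _ hj.le)).const_smul (√((j + 1 : ℕ) * h - j * h))⁻¹

theorem measurable_solution (S : IsScheme P ℱ w f g κ h r τ μ ψ y z) (n : ℕ) :
    Measurable[ℱ (n * h).toNNReal] (y n) ∧ Measurable[ℱ (n * h).toNNReal] (z n) := by
  induction n using Nat.strong_induction_on with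
  | _ n ih =>
    have hzj : ∀ j < n, Measurable[ℱ (n * h).toNNReal] (z j) := fun j hj =>
      (ih j hj).2.mono (ℱ.mono (S.monotone_grid hj.le)) le_rfl
    have hy : Measurable[ℱ (n * h).toNNReal] (y n) := by
      cases n with
      | zero =>
        have e : y 0 = ψ 0 := funext fun ω => (S.sol ω).init
        rw [e]
        exact (S.ψ_meas 0 ⟨by linarith [S.r_nonneg], le_rfl⟩).mono
          (ℱ.mono (zero_le (a := _))) le_rfl
      | succ n =>
        have hv : Measurable[ℱ ((n + 1 : ℕ) * h).toNNReal] (mem h τ μ ψ z n) :=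
          measurable_memory (S.measurable_ψ n _) fun j hj => hzj j (by omega)
        have hzn := hzj n (by omega)
        have hG : Measurable[ℱ ((n + 1 : ℕ) * h).toNNReal]
            fun ω => applyMat (g (z n ω) (mem h τ μ ψ z n ω)) (incr h w n ω) := by
          have hc : Continuous fun p : (Vec d × Vec d) × Vec m => applyMat (g p.1.1 p.1.2) p.2 :=
            continuous_applyMat.comp ((S.cont_g.comp continuous_fst).prodMk continuous_snd)
          exact hc.measurable.comp ((hzn.prodMk hv).prodMk (S.measurable_incr n.lt_succ_self))
        rw [show y (n + 1) = fun ω => z n ω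
          + √h • applyMat (g (z n ω) (mem h τ μ ψ z n ω)) (incr h w n ω) from funext (S.step_eq n)]
        exact hzn.add (hG.const_smul (√h))
    refine ⟨hy, ?_⟩
    set Mem : Ω → Vec d → Vec d := fun ω c => memory h τ μ (fun s => ψ s ω)
      (Function.update (fun j => z j ω) n c) n with hMem
    have hMemm : ∀ c, Measurable[ℱ (n * h).toNNReal] fun ω => Mem ω c := by
      intro c
      refine measurable_memory (z := fun j ω => Function.update (fun j => z j ω) n c j)
        (S.measurable_ψ n _) fun j hj => ?_
      rcases hj.lt_or_eq with h1 | rfl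
      · simpa [Function.update_of_ne h1.ne] using hzj j h1
      · simp
    refine measurable_of_unique_zero (F := fun ω c => c - (y n ω + h • f c (Mem ω c)))
      (fun c => ?_) (fun ω => ?_) (fun ω => ?_) fun ω c hc => ?_
    · refine measurable_const.sub (hy.add (Measurable.const_smul ?_ h))
      exact S.cont_f.measurable.comp (measurable_const.prodMk (hMemm c))
    · have := continuous_memory_update h τ μ (fun s => ψ s ω) (fun j => z j ω) n
      exact continuous_id.sub (continuous_const.add
        ((S.cont_f.comp (continuous_id.prodMk this)).const_smul h))
    · have := (S.sol ω).stage n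
      simp only [hMem]
      rw [show Function.update (fun j => z j ω) n (z n ω) = fun j => z j ω from
        Function.update_eq_self n _, sub_eq_zero]
      exact this
    · exact (S.sol ω).unique n c (sub_eq_zero.1 hc)

end IsScheme

/-! ### Adaptedness and moments of the split-step scheme -/

namespace IsScheme

variable {Ω : Type*} {d m : ℕ} [mΩ : MeasurableSpace Ω] {P : Measure Ω}
  {ℱ : Filtration ℝ≥0 (inferInstance : MeasurableSpace Ω)} {w : ℝ≥0 → Ω → Vec m}
  {f : Vec d → Vec d → Vec d} {g : Vec d → Vec d → Matrix (Fin d) (Fin m) ℝ} {κ h r : ℝ}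
  {τ : ℝ → ℝ} {μ : ℕ → ℝ} {ψ : ℝ → Ω → Vec d} {y z : ℕ → Ω → Vec d}

theorem measurable_mem (S : IsScheme P ℱ w f g κ h r τ μ ψ y z) (n : ℕ) :
    Measurable[ℱ (n * h).toNNReal] (mem h τ μ ψ z n) :=
  measurable_memory (S.measurable_ψ n _) fun j hj =>
    (S.measurable_solution j).2.mono (ℱ.mono (S.monotone_grid hj)) le_rfl

theorem measurable_size (S : IsScheme P ℱ w f g κ h r τ μ ψ y z) (n : ℕ) :
    Measurable[ℱ (n * h).toNNReal] (size z (mem h τ μ ψ z) n) := by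
  have h1 := ((measurable_norm.comp (S.measurable_solution n).2).pow_const 2).const_add 1
  exact h1.add ((measurable_norm.comp (S.measurable_mem n)).pow_const 2)

theorem measurable_martCoeff (S : IsScheme P ℱ w f g κ h r τ μ ψ y z) (n : ℕ) :
    Measurable[ℱ (n * h).toNNReal] (martCoeff g z (mem h τ μ ψ z) n) := by
  have hc : Continuous fun p : Vec d × Vec d => applyMat (g p.1 p.2).transpose p.1 :=
    continuous_applyMat.comp (S.cont_g.matrix_transpose.prodMk continuous_fst)
  exact (hc.measurable.comp
    ((S.measurable_solution n).2.prodMk (S.measurable_mem n))).const_smul (2 : ℝ)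

theorem measurable_applyMat_incr (S : IsScheme P ℱ w f g κ h r τ μ ψ y z) (n : ℕ) :
    Measurable fun ω => applyMat (g (z n ω) (mem h τ μ ψ z n ω)) (incr h w n ω) := by
  have hc : Continuous fun p : (Vec d × Vec d) × Vec m => applyMat (g p.1.1 p.1.2) p.2 :=
    continuous_applyMat.comp ((S.cont_g.comp continuous_fst).prodMk continuous_snd)
  exact hc.measurable.comp (((((S.measurable_solution n).2).mono (ℱ.le _) le_rfl).prodMk
    ((S.measurable_mem n).mono (ℱ.le _) le_rfl)).prodMk
    ((S.measurable_incr n.lt_succ_self).mono (ℱ.le _) le_rfl))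

theorem gaussian_incr (S : IsScheme P ℱ w f g κ h r τ μ ψ y z) (n : ℕ) :
    IsStdGaussianIndep (ℱ (n * h).toNNReal) P (incr h w n) := by
  have := S.h_pos
  exact S.wiener.isStdGaussianIndep_normIncr (by positivity) (by push_cast; linarith)

theorem norm_martCoeff_le (S : IsScheme P ℱ w f g κ h r τ μ ψ y z) (n : ℕ) (ω : Ω) :
    ‖martCoeff g z (mem h τ μ ψ z) n ω‖ ≤ 2 * κ * size z (mem h τ μ ψ z) n ω := by
  have hκ := S.one_le
  have hs := one_le_size z (mem h τ μ ψ z) n ω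
  have h1 : ‖z n ω‖ ^ 2 ≤ size z (mem h τ μ ψ z) n ω := by
    unfold size; nlinarith [sq_nonneg ‖mem h τ μ ψ z n ω‖]
  have h2 : ‖applyMat (g (z n ω) (mem h τ μ ψ z n ω)).transpose (z n ω)‖ ^ 2
      ≤ (κ * size z (mem h τ μ ψ z) n ω) ^ 2 := by
    refine (norm_applyMat_sq_le _ _).trans ?_
    rw [frobSq_transpose]
    calc _ ≤ κ * size z (mem h τ μ ψ z) n ω * size z (mem h τ μ ψ z) n ω := by
          gcongr
          exact S.frobSq_le n ω
      _ ≤ κ * size z (mem h τ μ ψ z) n ω * (κ * size z (mem h τ μ ψ z) n ω) := by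
          gcongr
          exact le_mul_of_one_le_left (by positivity) hκ
      _ = _ := by ring
  unfold martCoeff
  rw [norm_smul, Real.norm_two, mul_assoc]
  gcongr
  exact le_of_sq_le_sq h2 (by positivity)

theorem norm_sq_le_energy (S : IsScheme P ℱ w f g κ h r τ μ ψ y z) (n : ℕ) (ω : Ω) :
    ‖y n ω‖ ^ 2 ≤ energy h y (incr h w) (martCoeff g z (mem h τ μ ψ z))
      (gain g κ z (mem h τ μ ψ z) (incr h w)) n ω := by
  induction n with
  | zero => simp [energy]
  | succ n ih =>
    have h1 := S.norm_stage_sq_le n ω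
    have h2 : inner ℝ (martCoeff g z (mem h τ μ ψ z) n ω) (incr h w n ω)
        = 2 * inner ℝ (z n ω) (applyMat (g (z n ω) (mem h τ μ ψ z n ω)) (incr h w n ω)) := by
      rw [inner_applyMat, martCoeff, real_inner_smul_left]
    rw [S.step_eq, norm_add_sq_real, real_inner_smul_right, norm_smul,
      Real.norm_of_nonneg (Real.sqrt_nonneg h), mul_pow]
    unfold energy at ih ⊢
    rw [Finset.sum_range_succ, h2, gain]
    simp only [Real.sq_sqrt S.h_pos.le] at ih ⊢
    linarith

variable [IsProbabilityMeasure P]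

theorem moments_initialPart (S : IsScheme P ℱ w f g κ h r τ μ ψ y z) (n : ℕ) :
    AllMoments (fun ω => initialPart h τ (fun s => ψ s ω) n) P := by
  unfold initialPart
  split_ifs with h1
  · exact (S.ψ_moments _ ⟨S.delay n, h1.le⟩).norm.pow 2
  · exact AllMoments.const _

theorem moments_mem_of_le (S : IsScheme P ℱ w f g κ h r τ μ ψ y z) {n : ℕ}
    (hz : ∀ j ≤ n, AllMoments (z j) P) : AllMoments (mem h τ μ ψ z n) P := by
  have hm := ((S.measurable_mem n).mono (ℱ.le _) le_rfl).aestronglyMeasurable (μ := P)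
  refine AllMoments.of_sq hm (AllMoments.mono_real
    ((((hz n le_rfl).norm.pow 2).add (S.moments_initialPart n)).add
      (AllMoments.finset_sum (memoryIndices h τ n) fun j hj =>
        (hz j (lt_of_mem_memoryIndices hj).le).norm.pow 2))
    (hm.norm.pow 2) fun ω => ?_)
  rw [Real.norm_of_nonneg (sq_nonneg _)]
  exact norm_memory_sq_le h τ (fun s => ψ s ω) (fun j => z j ω) (S.weight n)

theorem moments_applyMat_incr_of_le (S : IsScheme P ℱ w f g κ h r τ μ ψ y z) {n : ℕ}
    (hz : ∀ j ≤ n, AllMoments (z j) P) :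
    AllMoments (fun ω => applyMat (g (z n ω) (mem h τ μ ψ z n ω)) (incr h w n ω)) P := by
  have hm := (S.measurable_applyMat_incr n).aestronglyMeasurable (μ := P)
  have m1 := hz n le_rfl
  have m2 := S.moments_mem_of_le hz
  have m3 := (S.gaussian_incr n).allMoments
  refine AllMoments.of_sq hm (AllMoments.mono_real
    (Y := fun ω => κ * size z (mem h τ μ ψ z) n ω * ‖incr h w n ω‖ ^ 2)
    (by unfold size; fun_prop) (hm.norm.pow 2) fun ω => ?_)
  rw [Real.norm_of_nonneg (sq_nonneg _)]
  exact S.norm_applyMat_incr_sq_le n ω _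

theorem moments_solution (S : IsScheme P ℱ w f g κ h r τ μ ψ y z) (n : ℕ) :
    AllMoments (y n) P ∧ AllMoments (z n) P := by
  induction n using Nat.strong_induction_on with
  | _ n ih =>
    have hy : AllMoments (y n) P := by
      cases n with
      | zero =>
        rw [show y 0 = ψ 0 from funext fun ω => (S.sol ω).init]
        exact S.ψ_moments 0 ⟨by linarith [S.r_nonneg], le_rfl⟩
      | succ n =>
        rw [show y (n + 1) = fun ω => z n ω
          + √h • applyMat (g (z n ω) (mem h τ μ ψ z n ω)) (incr h w n ω) from funext (S.step_eq n)]
        exact (ih n n.lt_succ_self).2.add ((AllMoments.const (√h)).smul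
          (S.moments_applyMat_incr_of_le fun j hj => (ih j (by omega)).2))
    refine ⟨hy, ?_⟩
    have hm := ((S.measurable_solution n).2.mono (ℱ.le _) le_rfl).aestronglyMeasurable (μ := P)
    refine AllMoments.of_sq hm (AllMoments.mono_real
      (Y := fun ω => 2 * ‖y n ω‖ ^ 2 + (1 + initialPart h τ (fun s => ψ s ω) n
        + ∑ j ∈ memoryIndices h τ n, ‖z j ω‖ ^ 2)) ?_ (hm.norm.pow 2) fun ω => ?_)
    · exact ((AllMoments.const 2).mul (hy.norm.pow 2)).add
        (((AllMoments.const 1).add (S.moments_initialPart n)).add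
          (AllMoments.finset_sum _ fun j hj =>
            (ih j (lt_of_mem_memoryIndices hj)).2.norm.pow 2))
    · rw [Real.norm_of_nonneg (sq_nonneg _)]
      have h1 := S.norm_stage_sq_le n ω
      have h2 := S.size_le n ω
      have h3 := initialPart_nonneg h τ (fun s => ψ s ω) n
      have h4 : 0 ≤ ∑ j ∈ memoryIndices h τ n, ‖z j ω‖ ^ 2 :=
        Finset.sum_nonneg fun j _ => sq_nonneg _
      have hp := S.h_pos
      have hκ := S.one_le
      have h5 := S.h_le
      have hx : 0 ≤ 2 * (h * κ) := by positivity
      have h6 := mul_le_mul_of_nonneg_left h2 hx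
      set R := 1 + initialPart h τ (fun s => ψ s ω) n
        + ∑ j ∈ memoryIndices h τ n, ‖z j ω‖ ^ 2 with hR
      have h7 : ‖z n ω‖ ^ 2 ≤ ‖y n ω‖ ^ 2 + 2 * (h * κ) * (2 * ‖z n ω‖ ^ 2 + R) := by
        rw [hR]; linarith
      have h8 : 2 * (h * κ) * (2 * ‖z n ω‖ ^ 2 + R) ≤ 1 / 4 * (2 * ‖z n ω‖ ^ 2 + R) := by
        gcongr
        linarith
      linarith

theorem moments_mem (S : IsScheme P ℱ w f g κ h r τ μ ψ y z) (n : ℕ) :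
    AllMoments (mem h τ μ ψ z n) P := S.moments_mem_of_le fun j _ => (S.moments_solution j).2

theorem moments_size (S : IsScheme P ℱ w f g κ h r τ μ ψ y z) (n : ℕ) :
    AllMoments (size z (mem h τ μ ψ z) n) P := by
  have := (S.moments_solution n).2
  have := S.moments_mem n
  unfold size
  fun_prop

theorem moments_gain (S : IsScheme P ℱ w f g κ h r τ μ ψ y z) (n : ℕ) :
    AllMoments (gain g κ z (mem h τ μ ψ z) (incr h w) n) P :=
  ((AllMoments.const (2 * κ)).mul (S.moments_size n)).add
    ((S.moments_applyMat_incr_of_le fun j _ => (S.moments_solution j).2).norm.pow 2)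

theorem moments_martCoeff (S : IsScheme P ℱ w f g κ h r τ μ ψ y z) (n : ℕ) :
    AllMoments (martCoeff g z (mem h τ μ ψ z) n) P :=
  ((AllMoments.const (2 * κ)).mul (S.moments_size n)).mono_real
    ((S.measurable_martCoeff n).mono (ℱ.le _) le_rfl).aestronglyMeasurable
    fun ω => S.norm_martCoeff_le n ω

/-- The split-step scheme satisfies the abstract energy recursion. -/
theorem isEnergyScheme (S : IsScheme P ℱ w f g κ h r τ μ ψ y z) :
    IsEnergyScheme (fun n : ℕ => ℱ (n * h).toNNReal) P κ h (incr h w)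
      (energy h y (incr h w) (martCoeff g z (mem h τ μ ψ z))
        (gain g κ z (mem h τ μ ψ z) (incr h w)))
      (fun n ω => ‖z n ω‖ ^ 2) (size z (mem h τ μ ψ z))
      (fun n ω => initialPart h τ (fun s => ψ s ω) n)
      (gain g κ z (mem h τ μ ψ z) (incr h w)) (martCoeff g z (mem h τ μ ψ z))
      (memoryIndices h τ) where
  mono i j hij := ℱ.mono (S.monotone_grid hij)
  gauss := S.gaussian_incr
  meas_X n := by
    have hmono : ∀ {i j : ℕ}, i ≤ j → ℱ (i * h).toNNReal ≤ ℱ (j * h).toNNReal := fun hij =>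
      ℱ.mono (S.monotone_grid hij)
    refine Measurable.add ((measurable_norm.comp
      ((S.measurable_solution 0).1.mono (hmono n.zero_le) le_rfl)).pow_const 2) ?_
    refine Finset.measurable_fun_sum _ fun j hj => ?_
    have hj' := Finset.mem_range.1 hj
    have hi := S.measurable_incr hj'
    have hH := (S.measurable_martCoeff j).mono (hmono hj'.le) le_rfl
    have hz := (S.measurable_solution j).2.mono (hmono hj'.le) le_rfl
    have hv := (S.measurable_mem j).mono (hmono hj'.le) le_rfl
    have hs := (S.measurable_size j).mono (hmono hj'.le) le_rfl
    have hc : Continuous fun p : (Vec d × Vec d) × Vec m => applyMat (g p.1.1 p.1.2) p.2 :=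
      continuous_applyMat.comp ((S.cont_g.comp continuous_fst).prodMk continuous_snd)
    have hG := hc.measurable.comp ((hz.prodMk hv).prodMk hi)
    exact ((hH.inner hi).const_mul _).add (((hs.const_mul _).add
      ((measurable_norm.comp hG).pow_const 2)).const_mul _)
  meas_c := S.measurable_size
  meas_H := S.measurable_martCoeff
  moments_X n := ((S.moments_solution 0).1.norm.pow 2).add
    (AllMoments.finset_sum _ fun j _ =>
      ((AllMoments.const _).mul ((S.moments_martCoeff j).inner (S.gaussian_incr j).allMoments)).add
        ((AllMoments.const _).mul (S.moments_gain j)))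
  moments_b n := (S.moments_solution n).2.norm.pow 2
  moments_c := S.moments_size
  moments_ρ := S.moments_initialPart
  moments_q := S.moments_gain
  moments_H := S.moments_martCoeff
  X_nonneg n ω := (sq_nonneg _).trans (S.norm_sq_le_energy n ω)
  b_nonneg n ω := sq_nonneg _
  c_nonneg n ω := zero_le_one.trans (one_le_size _ _ n ω)
  ρ_nonneg n ω := initialPart_nonneg _ _ _ n
  q_nonneg n ω := by
    have := S.one_le
    have := one_le_size z (mem h τ μ ψ z) n ω
    unfold gain
    positivity
  norm_H_le := S.norm_martCoeff_le
  q_le n ω := by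
    have hκ := S.one_le
    have hs := one_le_size z (mem h τ μ ψ z) n ω
    have h1 := S.norm_applyMat_incr_sq_le n ω (incr h w n ω)
    have h2 : 0 ≤ κ * size z (mem h τ μ ψ z) n ω * ‖incr h w n ω‖ ^ 2 := by positivity
    unfold gain
    linarith
  X_succ n ω := by
    unfold energy
    rw [Finset.sum_range_succ]
    ring
  b_le n ω := (S.norm_stage_sq_le n ω).trans (by gcongr; exact S.norm_sq_le_energy n ω)
  c_le := S.size_le
  J_lt n j hj := lt_of_mem_memoryIndices hj
  J_card := card_memoryIndices_le h τ

end IsScheme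

/-! ### Dominating functions for the suprema -/

/-- A bound for the mean of `maxEnergy` up to time `T`, when the `2k`-th moments of the squared norm
of the initial path are at most `Ψ`. -/
def maxConst (k : ℕ) (κ : ℝ) (m : ℕ) (T Ψ : ℝ) : ℝ := 1 + 4 * momentBound (2 * k) κ m T Ψ

/-- A bound for the mean of `maxStage` up to time `T`, when the `k`-th and `2k`-th moments of the
squared norm of the initial path are at most `Ψ` and `Ψ'`. -/
def stageConst (k : ℕ) (κ : ℝ) (m : ℕ) (T Ψ Ψ' : ℝ) : ℝ :=
  maxConst k κ m T Ψ' + (T + 1) * ((2 * κ) ^ k * momentBound k κ m T Ψ)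

/-- A random variable that dominates `X i ^ k` for `i ≤ N`. -/
def maxEnergy {Ω : Type*} (X : ℕ → Ω → ℝ) (k N : ℕ) (ω : Ω) : ℝ :=
  1 + (partialSups (fun i => X i ω ^ k) N) ^ 2

/-- A random variable that dominates `b i ^ k` for `i ≤ N` in the energy recursion. -/
def maxStage {Ω : Type*} (κ h : ℝ) (X c : ℕ → Ω → ℝ) (k N : ℕ) (ω : Ω) : ℝ :=
  maxEnergy X k N ω + h * ∑ j ∈ Finset.range (N + 1), (2 * κ) ^ k * (X j ω + c j ω) ^ k

namespace IsEnergyScheme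

variable {Ω : Type*} {m : ℕ} {𝒢 : ℕ → MeasurableSpace Ω} [mΩ : MeasurableSpace Ω]
  {P : Measure Ω} {κ h : ℝ} {ζ : ℕ → Ω → Vec m}
  {X b c ρ q : ℕ → Ω → ℝ} {H : ℕ → Ω → Vec m} {J : ℕ → Finset ℕ}

theorem X_pow_le_maxEnergy (S : IsEnergyScheme 𝒢 P κ h ζ X b c ρ q H J) (k : ℕ) {N i : ℕ}
    (hi : i ≤ N) (ω : Ω) : X i ω ^ k ≤ maxEnergy X k N ω := by
  have h1 := le_partialSups_of_le (fun i => X i ω ^ k) hi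
  have h2 := pow_nonneg (S.X_nonneg i ω) k
  unfold maxEnergy
  nlinarith [sq_nonneg (partialSups (fun i => X i ω ^ k) N - 1)]

theorem b_pow_le_maxStage (S : IsEnergyScheme 𝒢 P κ h ζ X b c ρ q H J) (hκ : 1 ≤ κ) (h0 : 0 ≤ h)
    (hh : 8 * κ * h ≤ 1) (k : ℕ) {N i : ℕ} (hi : i ≤ N) (ω : Ω) :
    b i ω ^ k ≤ maxStage κ h X c k N ω := by
  have hX := S.X_nonneg i ω
  have hc := S.c_nonneg i ω
  have h1 : h ≤ 1 := by nlinarith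
  calc b i ω ^ k ≤ (X i ω + h * (2 * κ * c i ω)) ^ k := by
        gcongr
        · exact S.b_nonneg i ω
        · exact S.b_le i ω
    _ ≤ X i ω ^ k + h * (X i ω + 2 * κ * c i ω) ^ k :=
        add_mul_pow_le hX (by positivity) h0 h1 k
    _ ≤ X i ω ^ k + h * (2 * κ * (X i ω + c i ω)) ^ k := by
        gcongr
        nlinarith
    _ = X i ω ^ k + h * ((2 * κ) ^ k * (X i ω + c i ω) ^ k) := by rw [mul_pow (2 * κ)]
    _ ≤ maxStage κ h X c k N ω := by
        unfold maxStage
        gcongr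
        · exact S.X_pow_le_maxEnergy k hi ω
        · refine Finset.single_le_sum (f := fun j => (2 * κ) ^ k * (X j ω + c j ω) ^ k)
            (fun j _ => ?_) (Finset.mem_range.2 (Nat.lt_succ_of_le hi))
          have := S.X_nonneg j ω
          have := S.c_nonneg j ω
          positivity

theorem maxStage_nonneg (S : IsEnergyScheme 𝒢 P κ h ζ X b c ρ q H J) (hκ : 1 ≤ κ) (h0 : 0 ≤ h)
    (hh : 8 * κ * h ≤ 1) (k N : ℕ) (ω : Ω) : 0 ≤ maxStage κ h X c k N ω :=
  (pow_nonneg (S.b_nonneg 0 ω) k).trans (S.b_pow_le_maxStage hκ h0 hh k N.zero_le ω)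

/-- A quantity controlled by the memory has its `k`-th power controlled by the maximum of the
stages and by the initial path. -/
theorem pow_le_of_le_memory (S : IsEnergyScheme 𝒢 P κ h ζ X b c ρ q H J) (hκ : 1 ≤ κ)
    (h0 : 0 ≤ h) (hh : 8 * κ * h ≤ 1) {k : ℕ} (hk : k ≠ 0) {N i : ℕ} (hi : i ≤ N) {ω : Ω} {a : ℝ}
    (ha0 : 0 ≤ a) (ha : a ≤ b i ω + ρ i ω + ∑ j ∈ J i, b j ω) :
    a ^ k ≤ 2 ^ k * (1 + 2 ^ k * (2 ^ k * 2)) * maxStage κ h X c k N ω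
      + 2 ^ k * 2 ^ k * ρ i ω ^ k := by
  have hD := S.maxStage_nonneg hκ h0 hh k N ω
  have hS : (∑ j ∈ J i, b j ω) ^ k ≤ 2 ^ k * (2 * maxStage κ h X c k N ω) := by
    refine (sum_pow_le_of_card_le_two (S.J_card i) (fun j _ => S.b_nonneg j ω) hk).trans ?_
    gcongr
    refine (Finset.sum_le_card_nsmul _ _ _ fun j hj =>
      S.b_pow_le_maxStage hκ h0 hh k ((S.J_lt i j hj).le.trans hi) ω).trans ?_
    rw [nsmul_eq_mul]
    gcongr
    exact_mod_cast S.J_card i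
  have hb := S.b_nonneg i ω
  have hρ := S.ρ_nonneg i ω
  have hs := S.sum_nonneg i ω
  calc a ^ k ≤ (b i ω + (ρ i ω + ∑ j ∈ J i, b j ω)) ^ k := by
        gcongr
        linarith
    _ ≤ 2 ^ k * (b i ω ^ k + (ρ i ω + ∑ j ∈ J i, b j ω) ^ k) :=
        add_pow_le_two_pow hb (add_nonneg hρ hs) k
    _ ≤ 2 ^ k * (b i ω ^ k + 2 ^ k * (ρ i ω ^ k + (∑ j ∈ J i, b j ω) ^ k)) := by
        gcongr
        exact add_pow_le_two_pow hρ hs k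
    _ ≤ 2 ^ k * (maxStage κ h X c k N ω
          + 2 ^ k * (ρ i ω ^ k + 2 ^ k * (2 * maxStage κ h X c k N ω))) := by
        gcongr
        exact S.b_pow_le_maxStage hκ h0 hh k hi ω
    _ = _ := by ring

variable [IsProbabilityMeasure P]

theorem moments_maxEnergy (S : IsEnergyScheme 𝒢 P κ h ζ X b c ρ q H J) (k N : ℕ) :
    AllMoments (maxEnergy X k N) P :=
  (AllMoments.const 1).add
    ((AllMoments.partialSups (fun i => (S.moments_X i).pow k) N).pow 2)

theorem moments_add_pow (S : IsEnergyScheme 𝒢 P κ h ζ X b c ρ q H J) (k j : ℕ) :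
    AllMoments (fun ω => (X j ω + c j ω) ^ k) P :=
  ((S.moments_X j).add (S.moments_c j)).pow k

theorem moments_maxStage (S : IsEnergyScheme 𝒢 P κ h ζ X b c ρ q H J) (k N : ℕ) :
    AllMoments (maxStage κ h X c k N) P :=
  (S.moments_maxEnergy k N).add ((AllMoments.const h).mul (AllMoments.finset_sum _ fun j _ =>
    (AllMoments.const _).mul (S.moments_add_pow k j)))

theorem integral_maxEnergy_le (S : IsEnergyScheme 𝒢 P κ h ζ X b c ρ q H J) (hκ : 1 ≤ κ)
    (h0 : 0 ≤ h) (hh : 8 * κ * h ≤ 1) {k : ℕ} (hk : k ≠ 0) {Ψ T : ℝ}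
    (hρ : ∀ n, ∫ ω, ρ n ω ^ (2 * k) ∂P ≤ Ψ) (hX : ∫ ω, X 0 ω ^ (2 * k) ∂P ≤ Ψ) {N : ℕ}
    (hN : N * h ≤ T) : ∫ ω, maxEnergy X k N ω ∂P ≤ maxConst k κ m T Ψ := by
  have h1 := S.integral_partialSups_pow_sq_le k N
  have h2 := S.integral_pow_le hκ h0 hh (k := 2 * k) (by omega) hρ hX hN
  have h3 : ∫ ω, X N ω ^ (2 * k) ∂P ≤ ∫ ω, (X N ω + c N ω) ^ (2 * k) ∂P := by
    refine integral_mono ((S.moments_X N).pow _).integrable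
      (S.moments_add_pow _ N).integrable fun ω => ?_
    have := S.X_nonneg N ω
    have := S.c_nonneg N ω
    simp only
    gcongr
    linarith
  unfold maxEnergy maxConst
  rw [integral_add (AllMoments.const 1).integrable
    ((AllMoments.partialSups (fun i => (S.moments_X i).pow k) N).pow 2).integrable]
  simp only [integral_const, probReal_univ, one_smul]
  linarith

theorem mul_sum_integral_le (S : IsEnergyScheme 𝒢 P κ h ζ X b c ρ q H J) (hκ : 1 ≤ κ)
    (h0 : 0 ≤ h) (hh : 8 * κ * h ≤ 1) {k : ℕ} (hk : k ≠ 0) {Ψ T : ℝ}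
    (hρ : ∀ n, ∫ ω, ρ n ω ^ k ∂P ≤ Ψ) (hX : ∫ ω, X 0 ω ^ k ∂P ≤ Ψ) {N : ℕ} (hN : N * h ≤ T) :
    h * ∑ j ∈ Finset.range (N + 1), ∫ ω, (X j ω + c j ω) ^ k ∂P
      ≤ (T + 1) * momentBound k κ m T Ψ := by
  have h1 : h ≤ 1 := by nlinarith
  have hle : ∀ j ≤ N, ∫ ω, (X j ω + c j ω) ^ k ∂P ≤ momentBound k κ m T Ψ := fun j hj =>
    S.integral_pow_le hκ h0 hh hk hρ hX (hN.trans' (by gcongr))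
  have hnn : 0 ≤ momentBound k κ m T Ψ :=
    (integral_nonneg fun ω => pow_nonneg (add_nonneg (S.X_nonneg 0 ω) (S.c_nonneg 0 ω)) k).trans
      (hle 0 N.zero_le)
  calc _ ≤ h * ((Finset.range (N + 1)).card • momentBound k κ m T Ψ) := by
        gcongr
        exact Finset.sum_le_card_nsmul _ _ _ fun j hj =>
          hle j (Nat.lt_succ_iff.1 (Finset.mem_range.1 hj))
    _ = (N * h + h) * momentBound k κ m T Ψ := by
        rw [Finset.card_range, nsmul_eq_mul]
        push_cast
        ring
    _ ≤ _ := by gcongr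

theorem integral_maxStage_le (S : IsEnergyScheme 𝒢 P κ h ζ X b c ρ q H J) (hκ : 1 ≤ κ)
    (h0 : 0 ≤ h) (hh : 8 * κ * h ≤ 1) {k : ℕ} (hk : k ≠ 0) {Ψ Ψ' T : ℝ}
    (hρ : ∀ n, ∫ ω, ρ n ω ^ k ∂P ≤ Ψ) (hX : ∫ ω, X 0 ω ^ k ∂P ≤ Ψ)
    (hρ' : ∀ n, ∫ ω, ρ n ω ^ (2 * k) ∂P ≤ Ψ') (hX' : ∫ ω, X 0 ω ^ (2 * k) ∂P ≤ Ψ') {N : ℕ}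
    (hN : N * h ≤ T) : ∫ ω, maxStage κ h X c k N ω ∂P ≤ stageConst k κ m T Ψ Ψ' := by
  have hm : ∀ j, AllMoments (fun ω => (2 * κ) ^ k * (X j ω + c j ω) ^ k) P := fun j =>
    (AllMoments.const _).mul (S.moments_add_pow k j)
  have h1 := S.integral_maxEnergy_le hκ h0 hh hk hρ' hX' hN
  have h2 := mul_le_mul_of_nonneg_left (S.mul_sum_integral_le hκ h0 hh hk hρ hX hN)
    (by positivity : 0 ≤ (2 * κ) ^ k)
  unfold maxStage stageConst
  rw [integral_add (S.moments_maxEnergy k N).integrable ((AllMoments.const h).mul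
      (AllMoments.finset_sum _ fun j _ => hm j)).integrable, integral_const_mul,
    integral_finsetSum _ fun j _ => (hm j).integrable]
  simp_rw [integral_const_mul]
  rw [← Finset.mul_sum]
  linarith

end IsEnergyScheme

/-! ### From dominating functions to suprema -/

theorem enorm_rpow_le_one_add {E : Type*} [NormedAddCommGroup E] (x : E) {p : ℝ} (hp : 0 ≤ p)
    {k : ℕ} (hk : p ≤ k) : ‖x‖ₑ ^ (2 * p) ≤ 1 + ENNReal.ofReal (‖x‖ ^ (2 * k)) := by
  rw [← ofReal_norm, ENNReal.ofReal_rpow_of_nonneg (norm_nonneg x) (by positivity),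
    ← ENNReal.ofReal_one, ← ENNReal.ofReal_add zero_le_one (by positivity)]
  refine ENNReal.ofReal_le_ofReal ?_
  rcases le_total ‖x‖ 1 with h | h
  · have := Real.rpow_le_one (norm_nonneg x) h (by positivity : 0 ≤ 2 * p)
    have : 0 ≤ ‖x‖ ^ (2 * k) := by positivity
    linarith
  · have h1 := Real.rpow_le_rpow_of_exponent_le h (by linarith : 2 * p ≤ 2 * (k : ℝ))
    have h2 : ‖x‖ ^ (2 * (k : ℝ)) = ‖x‖ ^ (2 * k) := by
      rw [← Real.rpow_natCast]; push_cast; rfl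
    linarith

theorem lintegral_iSup_enorm_rpow_le {Ω ι E : Type*} [MeasurableSpace Ω] {P : Measure Ω}
    [IsProbabilityMeasure P] [NormedAddCommGroup E] {Z : ι → Ω → E} {I : ι → Prop} {D : Ω → ℝ≥0∞}
    {p : ℝ} (hp : 0 ≤ p) {k : ℕ} (hk : p ≤ k)
    (hD : ∀ᵐ ω ∂P, ∀ i, I i → ENNReal.ofReal (‖Z i ω‖ ^ (2 * k)) ≤ D ω) :
    ∫⁻ ω, (⨆ (i) (_ : I i), ‖Z i ω‖ₑ ^ (2 * p)) ∂P ≤ 1 + ∫⁻ ω, D ω ∂P := by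
  calc _ ≤ ∫⁻ ω, (1 + D ω) ∂P := by
        refine lintegral_mono_ae (hD.mono fun ω hω => iSup₂_le fun i hi => ?_)
        exact (enorm_rpow_le_one_add _ hp hk).trans (by gcongr; exact hω i hi)
    _ = _ := by rw [lintegral_add_left measurable_const]; simp

theorem lintegral_ofReal_le {Ω : Type*} [MeasurableSpace Ω] {P : Measure Ω} {D : Ω → ℝ}
    (hD : AllMoments D P) (h0 : ∀ ω, 0 ≤ D ω) {B : ℝ} (hB : ∫ ω, D ω ∂P ≤ B) :
    ∫⁻ ω, ENNReal.ofReal (D ω) ∂P ≤ ENNReal.ofReal B := by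
  rw [← ofReal_integral_eq_lintegral_ofReal hD.integrable (.of_forall h0)]
  exact ENNReal.ofReal_le_ofReal hB

/-! ### Moment bounds for the suprema -/

/-- The `4k`-th moment of the standard Gaussian law on `ℝ^m`. -/
def gaussMoment (k m : ℕ) : ℝ := ∫ z, ‖z‖ ^ (4 * k) ∂(stdGaussian (Vec m))

/-- A bound for the mean of the supremum of `|ȳ(t)|^{2k}`, up to an additive constant. -/
def pathConst (k : ℕ) (κ : ℝ) (m : ℕ) (T Ψ Ψ' : ℝ) : ℝ :=
  6 ^ k * (maxConst k κ m T Ψ' + 2 ^ k * (stageConst k κ m T Ψ Ψ'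
    + κ ^ k * ((T + 1) * momentBound (2 * k) κ m T Ψ')))

namespace IsScheme

variable {Ω : Type*} {d m : ℕ} [mΩ : MeasurableSpace Ω] {P : Measure Ω}
  {ℱ : Filtration ℝ≥0 (inferInstance : MeasurableSpace Ω)} {w : ℝ≥0 → Ω → Vec m}
  {f : Vec d → Vec d → Vec d} {g : Vec d → Vec d → Matrix (Fin d) (Fin m) ℝ} {κ h r : ℝ}
  {τ : ℝ → ℝ} {μ : ℕ → ℝ} {ψ : ℝ → Ω → Vec d} {y z : ℕ → Ω → Vec d}

theorem integral_initialPart_pow_le (S : IsScheme P ℱ w f g κ h r τ μ ψ y z) {k : ℕ} (hk : k ≠ 0)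
    {Ψ : ℝ} (hΨ : ∀ s ∈ Icc (-r) 0, ∫ ω, ‖ψ s ω‖ ^ (2 * k) ∂P ≤ Ψ) (n : ℕ) :
    ∫ ω, initialPart h τ (fun s => ψ s ω) n ^ k ∂P ≤ Ψ := by
  have h0 : 0 ≤ Ψ := (integral_nonneg fun ω => by positivity).trans
    (hΨ 0 ⟨by linarith [S.r_nonneg], le_rfl⟩)
  unfold initialPart
  split_ifs with h1
  · simp_rw [← pow_mul]
    exact hΨ _ ⟨S.delay n, h1.le⟩
  · simpa [zero_pow hk] using h0

theorem integral_energy_zero_pow_le (S : IsScheme P ℱ w f g κ h r τ μ ψ y z) {k : ℕ}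
    {Ψ : ℝ} (hΨ : ∀ s ∈ Icc (-r) 0, ∫ ω, ‖ψ s ω‖ ^ (2 * k) ∂P ≤ Ψ) :
    ∫ ω, energy h y (incr h w) (martCoeff g z (mem h τ μ ψ z))
        (gain g κ z (mem h τ μ ψ z) (incr h w)) 0 ω ^ k ∂P ≤ Ψ := by
  have h0 : y 0 = ψ 0 := funext fun ω => (S.sol ω).init
  simp only [energy, Finset.range_zero, Finset.sum_empty, add_zero, h0, ← pow_mul]
  exact hΨ 0 ⟨by linarith [S.r_nonneg], le_rfl⟩

/-- On one step the interpolation is a convex combination of `y_n` and the stage, plus a Wiener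
increment. -/
theorem norm_contApprox_pow_le (S : IsScheme P ℱ w f g κ h r τ μ ψ y z) (k : ℕ) {t : ℝ}
    (ht : 0 < t) {n : ℕ} (hn : gridIndex h t = n) (ω : Ω) :
    ‖contApprox f g h τ μ (fun s => ψ s ω) (fun t => w t ω) (fun n => y n ω)
        (fun n => z n ω) t‖ ^ (2 * k)
      ≤ 6 ^ k * (‖y n ω‖ ^ (2 * k) + 2 ^ k * (‖z n ω‖ ^ (2 * k)
        + κ ^ k * (size z (mem h τ μ ψ z) n ω ^ k
          * ‖w t.toNNReal ω - w (Real.toNNReal (n * h)) ω‖ ^ (2 * k)))) := by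
  have hp := S.h_pos
  have hκ := S.one_le
  have hs := one_le_size z (mem h τ μ ψ z) n ω
  have hlo : n * h ≤ t := by
    rw [← le_div_iff₀ hp, ← hn]
    exact Nat.floor_le (by positivity)
  have hhi : t - n * h ≤ h := by
    have := Nat.lt_floor_add_one (t / h)
    rw [div_lt_iff₀ hp] at this
    rw [← hn]
    unfold gridIndex
    linarith
  set θ := (t - n * h) / h with hθ
  have hθ0 : 0 ≤ θ := div_nonneg (by linarith) hp.le
  have hθ1 : θ ≤ 1 := (div_le_one hp).2 hhi
  set e := applyMat (g (z n ω) (mem h τ μ ψ z n ω))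
    (w t.toNNReal ω - w (Real.toNNReal (n * h)) ω) with he
  have hval : contApprox f g h τ μ (fun s => ψ s ω) (fun t => w t ω) (fun n => y n ω)
      (fun n => z n ω) t = ((1 - θ) • y n ω + θ • z n ω) + e := by
    have h1 : h • f (z n ω) (mem h τ μ ψ z n ω) = z n ω - y n ω := by
      rw [eq_sub_iff_add_eq', ← S.stage_eq n ω]
    have h2 : (t - n * h) • f (z n ω) (mem h τ μ ψ z n ω) = θ • (z n ω - y n ω) := by
      rw [← h1, smul_smul, hθ, div_mul_cancel₀ _ hp.ne']
    have h3 : y n ω + (t - n * h) • f (z n ω) (mem h τ μ ψ z n ω)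
        = (1 - θ) • y n ω + θ • z n ω := by
      rw [h2, smul_sub, sub_smul, one_smul]
      abel
    rw [← h3]
    simp only [contApprox, if_neg ht.not_ge, hn]
    rfl
  have hnorm : ‖((1 - θ) • y n ω + θ • z n ω) + e‖ ≤ ‖y n ω‖ + ‖z n ω‖ + ‖e‖ := by
    refine (norm_add_le _ _).trans ?_
    gcongr
    refine (norm_add_le _ _).trans ?_
    rw [norm_smul, norm_smul, Real.norm_of_nonneg hθ0, Real.norm_of_nonneg (by linarith)]
    gcongr
    · exact mul_le_of_le_one_left (norm_nonneg _) (by linarith)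
    · exact mul_le_of_le_one_left (norm_nonneg _) hθ1
  have hesq : ‖e‖ ^ 2 ≤ κ * size z (mem h τ μ ψ z) n ω
      * ‖w t.toNNReal ω - w (Real.toNNReal (n * h)) ω‖ ^ 2 :=
    S.norm_applyMat_incr_sq_le n ω _
  set G := κ * size z (mem h τ μ ψ z) n ω
      * ‖w t.toNNReal ω - w (Real.toNNReal (n * h)) ω‖ ^ 2 with hG
  have hG0 : 0 ≤ G := by positivity
  rw [hval, pow_mul]
  calc (‖((1 - θ) • y n ω + θ • z n ω) + e‖ ^ 2) ^ k
      ≤ (3 * (‖y n ω‖ ^ 2 + (‖z n ω‖ ^ 2 + G))) ^ k := by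
        gcongr
        calc _ ≤ (‖y n ω‖ + ‖z n ω‖ + ‖e‖) ^ 2 := by gcongr
          _ ≤ 3 * (‖y n ω‖ ^ 2 + (‖z n ω‖ ^ 2 + ‖e‖ ^ 2)) := by
            nlinarith [sq_nonneg (‖y n ω‖ - ‖z n ω‖), sq_nonneg (‖y n ω‖ - ‖e‖),
              sq_nonneg (‖z n ω‖ - ‖e‖)]
          _ ≤ _ := by gcongr
    _ = 3 ^ k * (‖y n ω‖ ^ 2 + (‖z n ω‖ ^ 2 + G)) ^ k := mul_pow _ _ _
    _ ≤ 3 ^ k * (2 ^ k * ((‖y n ω‖ ^ 2) ^ k + (2 ^ k * ((‖z n ω‖ ^ 2) ^ k + G ^ k)))) := by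
        gcongr
        refine (add_pow_le_two_pow (sq_nonneg _) (by positivity) k).trans ?_
        gcongr
        exact add_pow_le_two_pow (sq_nonneg _) hG0 k
    _ = _ := by
        rw [hG, mul_pow, mul_pow, pow_mul ‖y n ω‖, pow_mul ‖z n ω‖,
          pow_mul ‖w t.toNNReal ω - w (Real.toNNReal (n * h)) ω‖,
          show (6 : ℝ) ^ k = 3 ^ k * 2 ^ k by rw [← mul_pow]; norm_num]
        ring

variable [IsProbabilityMeasure P]

/-- The moment bounds for the suprema over `[0, T]`, with constants that depend on the scheme only
through `κ` and the dimension `m`. -/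
theorem lintegral_iSup_le (S : IsScheme P ℱ w f g κ h r τ μ ψ y z) {k : ℕ} (hk : k ≠ 0) {p T : ℝ}
    (hp : 0 ≤ p) (hpk : p ≤ k) (hT : 0 ≤ T) {Ψ Ψ' : ℝ}
    (hΨ : ∀ s ∈ Icc (-r) 0, ∫ ω, ‖ψ s ω‖ ^ (2 * k) ∂P ≤ Ψ)
    (hΨ' : ∀ s ∈ Icc (-r) 0, ∫ ω, ‖ψ s ω‖ ^ (2 * (2 * k)) ∂P ≤ Ψ') :
    ∫⁻ ω, (⨆ (n : ℕ) (_ : (n : ℝ) * h ≤ T), ‖z n ω‖ₑ ^ (2 * p)) ∂P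
        ≤ 1 + ENNReal.ofReal (stageConst k κ m T Ψ Ψ') ∧
    ∫⁻ ω, (⨆ t ∈ Icc (0 : ℝ) T, ‖memoryCont h τ μ (fun s => ψ s ω)
        (fun n => z n ω) t‖ₑ ^ (2 * p)) ∂P
        ≤ 1 + (ENNReal.ofReal (2 ^ k * (1 + 2 ^ k * (2 ^ k * 2)) * stageConst k κ m T Ψ Ψ')
          + ENNReal.ofReal (2 ^ k * 2 ^ k)
            * ∫⁻ ω, (⨆ s ∈ Icc (-r) 0, ‖ψ s ω‖ₑ ^ ((2 * k : ℕ) : ℝ)) ∂P) ∧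
    ∫⁻ ω, (⨆ t ∈ Icc (0 : ℝ) T, ‖contApprox f g h τ μ (fun s => ψ s ω)
        (fun t => w t ω) (fun n => y n ω) (fun n => z n ω) t‖ₑ ^ (2 * p)) ∂P
        ≤ 1 + (ENNReal.ofReal (pathConst k κ m T Ψ Ψ')
          + ENNReal.ofReal (6 ^ k * 2 ^ k * κ ^ k * (4 * gaussMoment k m * (T + 1)))) := by
  have hh := S.h_pos
  have hκ := S.one_le
  have hh8 := S.h_le
  have h1 : h ≤ 1 := by nlinarith
  set N := ⌊T / h⌋₊ with hN
  have hNT : N * h ≤ T := by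
    rw [← le_div_iff₀ hh]
    exact Nat.floor_le (by positivity)
  have hgrid : ∀ {t : ℝ}, t ≤ T → gridIndex h t ≤ N := fun ht => by
    unfold gridIndex
    exact Nat.floor_le_floor (by gcongr)
  set E := S.isEnergyScheme with hE
  set X := energy h y (incr h w) (martCoeff g z (mem h τ μ ψ z))
    (gain g κ z (mem h τ μ ψ z) (incr h w)) with hX
  set c := size z (mem h τ μ ψ z) with hc
  have hρ1 := S.integral_initialPart_pow_le hk hΨ
  have hρ2 := S.integral_initialPart_pow_le (k := 2 * k) (by omega) hΨ'
  have hX1 := S.integral_energy_zero_pow_le hΨ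
  have hX2 := S.integral_energy_zero_pow_le hΨ'
  have mD1 := E.moments_maxEnergy k N
  have mD2 := E.moments_maxStage k N
  have iD1 := E.integral_maxEnergy_le hκ hh.le hh8 hk hρ2 hX2 hNT
  have iD2 := E.integral_maxStage_le hκ hh.le hh8 hk hρ1 hX1 hρ2 hX2 hNT
  have nD2 := E.maxStage_nonneg hκ hh.le hh8 k N
  have hz : ∀ {n : ℕ}, n ≤ N → ∀ ω, ‖z n ω‖ ^ (2 * k) ≤ maxStage κ h X c k N ω := fun hn ω => by
    rw [pow_mul]
    exact E.b_pow_le_maxStage hκ hh.le hh8 k hn ω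
  have hy : ∀ {n : ℕ}, n ≤ N → ∀ ω, ‖y n ω‖ ^ (2 * k) ≤ maxEnergy X k N ω := fun hn ω => by
    rw [pow_mul]
    exact (pow_le_pow_left₀ (sq_nonneg _) (S.norm_sq_le_energy _ ω) k).trans
      (E.X_pow_le_maxEnergy k hn ω)
  refine ⟨?_, ?_, ?_⟩
  · refine (lintegral_iSup_enorm_rpow_le hp hpk
      (D := fun ω => ENNReal.ofReal (maxStage κ h X c k N ω))
      (.of_forall fun ω n hn => ENNReal.ofReal_le_ofReal (hz ?_ ω))).trans ?_
    · exact Nat.le_floor (by rwa [le_div_iff₀ hh])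
    · gcongr
      exact lintegral_ofReal_le mD2 nD2 iD2
  · set C := (2 : ℝ) ^ k * (1 + 2 ^ k * (2 ^ k * 2)) with hC
    have mC : AllMoments (fun ω => C * maxStage κ h X c k N ω) P := (AllMoments.const C).mul mD2
    set M : Ω → ℝ≥0∞ := fun ω => ENNReal.ofReal (2 ^ k * 2 ^ k)
      * partialSups (fun i => ENNReal.ofReal (initialPart h τ (fun s => ψ s ω) i ^ k)) N with hM
    refine (lintegral_iSup_enorm_rpow_le hp hpk
      (D := fun ω => ENNReal.ofReal (C * maxStage κ h X c k N ω) + M ω)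
      (.of_forall fun ω t ht => ?_)).trans ?_
    · have hn := hgrid ht.2
      set n := gridIndex h t with hnt
      have h2 := E.pow_le_of_le_memory hκ hh.le hh8 hk hn (ω := ω) (sq_nonneg _)
        (norm_memory_sq_le h τ (fun s => ψ s ω) (fun j => z j ω) (S.weight n))
      rw [← pow_mul] at h2
      refine (ENNReal.ofReal_le_ofReal h2).trans ?_
      refine ENNReal.ofReal_add_le.trans (add_le_add_right ?_ _)
      rw [ENNReal.ofReal_mul (by positivity)]
      simp only [hM]
      gcongr
      exact le_partialSups_of_le
        (fun i => ENNReal.ofReal (initialPart h τ (fun s => ψ s ω) i ^ k)) hn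
    -- The supremum of the initial path over `[-r, 0]` need not be measurable; only the first
    -- summand has to be for the integral to split.
    · gcongr 1 + ?_
      rw [lintegral_add_left' mC.aestronglyMeasurable.aemeasurable.ennreal_ofReal]
      gcongr ?_ + ?_
      · refine lintegral_ofReal_le mC (fun ω => mul_nonneg (by positivity) (nD2 ω)) ?_
        rw [integral_const_mul]
        gcongr
      · rw [← lintegral_const_mul' _ _ ENNReal.ofReal_ne_top]
        refine lintegral_mono fun ω => ?_
        simp only [hM]
        gcongr
        refine partialSups_le _ _ _ fun i _ => ?_
        unfold initialPart
        split_ifs with h2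
        · refine le_trans (le_of_eq ?_) (le_iSup₂ (f := fun s (_ : s ∈ Icc (-r) 0) =>
            ‖ψ s ω‖ₑ ^ ((2 * k : ℕ) : ℝ)) (i * h - τ (i * h)) ⟨S.delay i, h2.le⟩)
          rw [ENNReal.rpow_natCast, ← ofReal_norm, ENNReal.ofReal_pow (sq_nonneg _),
            ENNReal.ofReal_pow (norm_nonneg _), pow_mul]
        · simp [zero_pow hk]
  · choose W hWm hWi hWle using fun j : ℕ => S.wiener.exists_lintegral_le_of_increment
      (s := j * h) (by positivity) hh k
    set R : Ω → ℝ := fun ω => 6 ^ k * (maxEnergy X k N ω + 2 ^ k * (maxStage κ h X c k N ω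
      + κ ^ k * (h * ∑ j ∈ Finset.range (N + 1), (X j ω + c j ω) ^ (2 * k)))) with hR
    have nX : ∀ j ω, 0 ≤ X j ω := E.X_nonneg
    have nc : ∀ j ω, 0 ≤ c j ω := E.c_nonneg
    have mS : AllMoments (fun ω => ∑ j ∈ Finset.range (N + 1), (X j ω + c j ω) ^ (2 * k)) P :=
      AllMoments.finset_sum _ fun j _ => E.moments_add_pow _ j
    have mR : AllMoments R P := by fun_prop
    have nD1 : ∀ ω, 0 ≤ maxEnergy X k N ω := fun ω =>
      (by positivity : 0 ≤ ‖y 0 ω‖ ^ (2 * k)).trans (hy N.zero_le ω)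
    have nS : ∀ ω, 0 ≤ ∑ j ∈ Finset.range (N + 1), (X j ω + c j ω) ^ (2 * k) := fun ω =>
      Finset.sum_nonneg fun j _ => pow_nonneg (add_nonneg (nX j ω) (nc j ω)) _
    have nR : ∀ ω, 0 ≤ R ω := fun ω => by
      have := nD1 ω
      have := nD2 ω
      have := nS ω
      simp only [hR]
      positivity
    have iR : ∫ ω, R ω ∂P ≤ pathConst k κ m T Ψ Ψ' := by
      simp only [hR]
      unfold pathConst
      rw [integral_const_mul, integral_add mD1.integrable (AllMoments.integrable (by fun_prop)),
        integral_const_mul, integral_add mD2.integrable (AllMoments.integrable (by fun_prop)),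
        integral_const_mul, integral_const_mul,
        integral_finsetSum _ fun j _ => (E.moments_add_pow _ j).integrable]
      have hsum := E.mul_sum_integral_le hκ hh.le hh8 (k := 2 * k) (by omega) hρ2 hX2 hNT
      refine mul_le_mul_of_nonneg_left (add_le_add iD1 (mul_le_mul_of_nonneg_left
        (add_le_add iD2 (mul_le_mul_of_nonneg_left hsum ?_)) ?_)) ?_ <;> positivity
    set B := (6 : ℝ) ^ k * 2 ^ k * κ ^ k with hB
    have hB0 : 0 ≤ B := by positivity
    refine (lintegral_iSup_enorm_rpow_le hp hpk
      (D := fun ω => ENNReal.ofReal (R ω)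
        + ENNReal.ofReal (B * h⁻¹) * ∑ j ∈ Finset.range (N + 1), W j ω) ?_).trans ?_
    · filter_upwards [ae_all_iff.2 hWle] with ω hω t ht
      rcases ht.1.eq_or_lt with rfl | ht0
      · refine le_add_right (ENNReal.ofReal_le_ofReal ?_)
        have e : contApprox f g h τ μ (fun s => ψ s ω) (fun t => w t ω) (fun n => y n ω)
            (fun n => z n ω) 0 = y 0 ω := by
          rw [contApprox, if_pos le_rfl]
          exact (S.sol ω).init.symm
        rw [e]
        refine (hy N.zero_le ω).trans ?_
        have := nD1 ω
        have := nD2 ω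
        have := nS ω
        refine (le_add_of_nonneg_right ?_).trans
          (le_mul_of_one_le_left ?_ (one_le_pow₀ (by norm_num : (1 : ℝ) ≤ 6)))
        · positivity
        · positivity
      · have hn := hgrid ht.2
        obtain ⟨n, hnt⟩ : ∃ n, gridIndex h t = n := ⟨_, rfl⟩
        rw [hnt] at hn
        have hmem : t ∈ Icc (n * h) (n * h + h) := by
          constructor
          · rw [← le_div_iff₀ hh, ← hnt]
            exact Nat.floor_le (by positivity)
          · have := Nat.lt_floor_add_one (t / h)
            rw [div_lt_iff₀ hh] at this
            rw [← hnt]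
            unfold gridIndex
            linarith
        set u := ‖w t.toNNReal ω - w (Real.toNNReal (n * h)) ω‖ with hu
        -- Young's inequality with weight `h`; the loss `h⁻¹` is compensated by the size
        -- `h ^ (2 * k)` of the moments of the increment.
        have hyoung : c n ω ^ k * u ^ (2 * k) ≤ h * c n ω ^ (2 * k) + h⁻¹ * u ^ (4 * k) := by
          have e1 : c n ω ^ (2 * k) = (c n ω ^ k) ^ 2 := by rw [← pow_mul]; ring_nf
          have e2 : u ^ (4 * k) = (u ^ (2 * k)) ^ 2 := by rw [← pow_mul]; ring_nf
          rw [e1, e2]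
          have h2 := sq_nonneg (√h * c n ω ^ k - (√h)⁻¹ * u ^ (2 * k))
          have hs : 0 < √h := Real.sqrt_pos.2 hh
          have h3 : (√h * c n ω ^ k - (√h)⁻¹ * u ^ (2 * k)) ^ 2 = √h ^ 2 * (c n ω ^ k) ^ 2
              - 2 * (c n ω ^ k * u ^ (2 * k)) + (√h ^ 2)⁻¹ * (u ^ (2 * k)) ^ 2 := by
            field_simp
            ring
          rw [h3, Real.sq_sqrt hh.le] at h2
          have h4 : 0 ≤ c n ω ^ k * u ^ (2 * k) := by
            have := nc n ω
            positivity
          linarith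
        have hcs : c n ω ^ (2 * k)
            ≤ ∑ j ∈ Finset.range (N + 1), (X j ω + c j ω) ^ (2 * k) := by
          refine le_trans ?_ (Finset.single_le_sum (f := fun j => (X j ω + c j ω) ^ (2 * k))
            (fun j _ => pow_nonneg (add_nonneg (nX j ω) (nc j ω)) _)
            (Finset.mem_range.2 (Nat.lt_succ_of_le hn)))
          have := nc n ω
          have := nX n ω
          gcongr
          linarith
        have hreal : ‖contApprox f g h τ μ (fun s => ψ s ω) (fun t => w t ω) (fun n => y n ω)
            (fun n => z n ω) t‖ ^ (2 * k) ≤ R ω + B * h⁻¹ * u ^ (4 * k) := by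
          refine (S.norm_contApprox_pow_le k ht0 hnt ω).trans ?_
          calc _ ≤ 6 ^ k * (maxEnergy X k N ω + 2 ^ k * (maxStage κ h X c k N ω + κ ^ k
                * (h * ∑ j ∈ Finset.range (N + 1), (X j ω + c j ω) ^ (2 * k)
                  + h⁻¹ * u ^ (4 * k)))) := by
                gcongr
                · exact hy hn ω
                · exact hz hn ω
                · exact hyoung.trans (by gcongr)
            _ = _ := by simp only [hR, hB]; ring
        refine (ENNReal.ofReal_le_ofReal hreal).trans ?_
        refine ENNReal.ofReal_add_le.trans (add_le_add_right ?_ _)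
        rw [ENNReal.ofReal_mul (by positivity)]
        gcongr
        exact (hω n t hmem).trans (Finset.single_le_sum (f := fun j => W j ω)
          (fun _ _ => zero_le) (Finset.mem_range.2 (Nat.lt_succ_of_le hn)))
    · gcongr 1 + ?_
      rw [lintegral_add_left' mR.aestronglyMeasurable.aemeasurable.ennreal_ofReal]
      gcongr ?_ + ?_
      · exact lintegral_ofReal_le mR nR iR
      · have hΓ : 0 ≤ gaussMoment k m := integral_nonneg fun z => by positivity
        rw [lintegral_const_mul' _ _ ENNReal.ofReal_ne_top,
          lintegral_finsetSum _ fun j _ => hWm j]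
        calc _ ≤ ENNReal.ofReal (B * h⁻¹) * ((Finset.range (N + 1)).card
              • ENNReal.ofReal (4 * (h ^ (2 * k) * gaussMoment k m))) := by
              gcongr
              exact Finset.sum_le_card_nsmul _ _ _ fun j _ => hWi j
          _ = ENNReal.ofReal (B * h⁻¹ * ((N + 1) * (4 * (h ^ (2 * k) * gaussMoment k m)))) := by
              rw [Finset.card_range, nsmul_eq_mul, ← ENNReal.ofReal_natCast,
                ← ENNReal.ofReal_mul (by positivity), ← ENNReal.ofReal_mul (by positivity)]
              push_cast
              rfl
          _ ≤ _ := by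
              refine ENNReal.ofReal_le_ofReal ?_
              have h2 : h ^ (2 * k) ≤ h ^ 2 := pow_le_pow_of_le_one hh.le h1 (by omega)
              calc _ ≤ B * h⁻¹ * ((N + 1) * (4 * (h ^ 2 * gaussMoment k m))) := by gcongr
                _ = B * (4 * gaussMoment k m * (N * h + h)) := by
                    field_simp
                _ ≤ _ := by gcongr

end IsScheme

/-- The moments of the initial path are controlled by those of its supremum. -/
theorem initialPath_moments {Ω : Type*} [MeasurableSpace Ω] {P : Measure Ω} [IsProbabilityMeasure P]
    {d : ℕ} {ψ : ℝ → Ω → Vec d} {I : Set ℝ} (hm : ∀ s ∈ I, Measurable (ψ s))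
    (hψ : ∀ q : ℝ, 0 < q → ∫⁻ ω, (⨆ s ∈ I, ‖ψ s ω‖ₑ ^ q) ∂P < ∞) {s : ℝ} (hs : s ∈ I) :
    AllMoments (ψ s) P ∧ ∀ k : ℕ, k ≠ 0 → ∫ ω, ‖ψ s ω‖ ^ k ∂P
      ≤ (∫⁻ ω, (⨆ s ∈ I, ‖ψ s ω‖ₑ ^ (k : ℝ)) ∂P).toReal := by
  have hle : ∀ q : ℝ, ∫⁻ ω, ‖ψ s ω‖ₑ ^ q ∂P ≤ ∫⁻ ω, (⨆ s ∈ I, ‖ψ s ω‖ₑ ^ q) ∂P := fun q =>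
    lintegral_mono fun ω => le_iSup₂ (f := fun s (_ : s ∈ I) => ‖ψ s ω‖ₑ ^ q) s hs
  constructor
  · intro p
    refine ⟨(hm s hs).aestronglyMeasurable, ?_⟩
    rcases eq_or_ne p 0 with rfl | hp
    · simp
    · rw [eLpNorm_lt_top_iff_lintegral_rpow_enorm_lt_top (by simpa using hp) (by simp)]
      exact (hle _).trans_lt (hψ _ (by simpa using pos_iff_ne_zero.2 hp))
  · intro k hk
    rw [integral_eq_lintegral_of_nonneg_ae (.of_forall fun ω => by positivity)
      ((hm s hs).norm.pow_const k).aestronglyMeasurable]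
    refine ENNReal.toReal_mono (hψ _ (by positivity)).ne (le_trans (le_of_eq ?_) (hle k))
    refine lintegral_congr fun ω => ?_
    rw [ENNReal.rpow_natCast, ENNReal.ofReal_pow (norm_nonneg _), ofReal_norm]

end SSBE

end

theorem mainTheorem9 {Ω : Type*} [MeasurableSpace Ω] (P : Measure Ω) [IsProbabilityMeasure P]
    (ℱ : Filtration ℝ≥0 (inferInstance : MeasurableSpace Ω)) {d m : ℕ}
    (w : ℝ≥0 → Ω → SSBE.Vec m) (hw : SSBE.IsWiener P ℱ w)
    (f : SSBE.Vec d → SSBE.Vec d → SSBE.Vec d)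
    (g : SSBE.Vec d → SSBE.Vec d → Matrix (Fin d) (Fin m) ℝ)
    (hf : Continuous (Function.uncurry f)) (hg : Continuous (Function.uncurry g))
    (K : ℝ) (hK : SSBE.MonotoneGrowth f g K)
    (τ : ℝ → ℝ) (hτ : ∀ t, 0 ≤ t → 0 ≤ τ t)
    (r : ℝ) (hr : IsGLB ((fun t => t - τ t) '' Ici 0) (-r))
    (ψ : ℝ → Ω → SSBE.Vec d) (hψ : ∀ s ∈ Icc (-r) 0, Measurable[ℱ 0] (ψ s))
    (hψmom : ∀ q : ℝ, 0 < q → ∫⁻ ω, (⨆ s ∈ Icc (-r) 0, ‖ψ s ω‖ₑ ^ q) ∂P < ∞) :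
    ∃ h₀ : ℝ, 0 < h₀ ∧ h₀ < 1 ∧ ∀ T : ℝ, 0 ≤ T → ∀ p : ℝ, 2 ≤ p → ∃ A : ℝ≥0,
      ∀ h : ℝ, 0 < h → h < h₀ → ∀ μ : ℕ → ℝ, (∀ n, 0 ≤ μ n ∧ μ n < 1) →
      ∀ y ystar : ℕ → Ω → SSBE.Vec d,
        (∀ ω, SSBE.IsNumericalSolution f g h τ μ (fun s => ψ s ω) (fun t => w t ω)
          (fun n => y n ω) (fun n => ystar n ω)) →
        ∫⁻ ω, (⨆ (n : ℕ) (_ : (n : ℝ) * h ≤ T), ‖ystar n ω‖ₑ ^ (2 * p)) ∂P ≤ A ∧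
        ∫⁻ ω, (⨆ t ∈ Icc (0 : ℝ) T, ‖SSBE.memoryCont h τ μ (fun s => ψ s ω)
          (fun n => ystar n ω) t‖ₑ ^ (2 * p)) ∂P ≤ A ∧
        ∫⁻ ω, (⨆ t ∈ Icc (0 : ℝ) T, ‖SSBE.contApprox f g h τ μ (fun s => ψ s ω)
          (fun t => w t ω) (fun n => y n ω) (fun n => ystar n ω) t‖ₑ ^ (2 * p)) ∂P ≤ A := by
  -- A growth constant of at least `1` gives `√κ ≤ κ`, and makes `8 κ h ≤ 1` imply `h ≤ 1`.
  set κ := max K 1 with hκ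
  have hκ1 : 1 ≤ κ := le_max_right _ _
  have hgrow : SSBE.MonotoneGrowth f g κ := fun x y => (hK x y).trans (by
    gcongr
    exact le_max_left _ _)
  have hr0 : 0 ≤ r := by
    have h1 : -r ≤ 0 - τ 0 := hr.1 ⟨0, self_mem_Ici, rfl⟩
    linarith [hτ 0 le_rfl]
  have hmeas : ∀ s ∈ Icc (-r) 0, Measurable (ψ s) := fun s hs => (hψ s hs).mono (ℱ.le 0) le_rfl
  -- Below this step size the implicit term is absorbed, for every moment order at once.
  refine ⟨1 / (8 * κ), by positivity, ?_, ?_⟩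
  · rw [div_lt_one (by positivity)]
    linarith
  intro T hT p hp
  -- A natural number above `p` suffices, since `P` is a probability measure.
  obtain ⟨k, hpk⟩ := exists_nat_ge p
  have hk : k ≠ 0 := by
    rintro rfl
    norm_num at hpk
    linarith
  set Ψ : ℕ → ℝ≥0∞ := fun j => ∫⁻ ω, (⨆ s ∈ Icc (-r) 0, ‖ψ s ω‖ₑ ^ (j : ℝ)) ∂P with hΨ
  have hΨtop : Ψ (2 * k) ≠ ∞ := (hψmom _ (by positivity)).ne
  set a := 1 + ENNReal.ofReal
    (SSBE.stageConst k κ m T (Ψ (2 * k)).toReal (Ψ (2 * (2 * k))).toReal) with ha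
  set b := 1 + (ENNReal.ofReal (2 ^ k * (1 + 2 ^ k * (2 ^ k * 2))
    * SSBE.stageConst k κ m T (Ψ (2 * k)).toReal (Ψ (2 * (2 * k))).toReal)
    + ENNReal.ofReal (2 ^ k * 2 ^ k) * Ψ (2 * k)) with hb
  set c := 1 + (ENNReal.ofReal
    (SSBE.pathConst k κ m T (Ψ (2 * k)).toReal (Ψ (2 * (2 * k))).toReal)
    + ENNReal.ofReal (6 ^ k * 2 ^ k * κ ^ k * (4 * SSBE.gaussMoment k m * (T + 1)))) with hc
  have hfin : max a (max b c) ≠ ∞ := by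
    have h1 : a ≠ ∞ := by finiteness
    have h2 : b ≠ ∞ := by finiteness
    have h3 : c ≠ ∞ := by finiteness
    exact (max_lt h1.lt_top (max_lt h2.lt_top h3.lt_top)).ne
  refine ⟨(max a (max b c)).toNNReal, fun h hh0 hh μ hμ y ystar hsol => ?_⟩
  rw [ENNReal.coe_toNNReal hfin]
  have S : SSBE.IsScheme P ℱ w f g κ h r τ μ ψ y ystar :=
    { wiener := hw
      cont_f := hf
      cont_g := hg
      growth := hgrow
      one_le := hκ1
      h_pos := hh0
      h_le := by
        rw [lt_div_iff₀ (by positivity)] at hh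
        linarith
      weight := hμ
      r_nonneg := hr0
      delay := fun n => hr.1 ⟨n * h, mem_Ici.2 (by positivity), rfl⟩
      ψ_meas := hψ
      ψ_moments := fun s hs => (SSBE.initialPath_moments hmeas hψmom hs).1
      sol := hsol }
  obtain ⟨h1, h2, h3⟩ := S.lintegral_iSup_le hk (by linarith) hpk hT
    (fun s hs => (SSBE.initialPath_moments hmeas hψmom hs).2 _ (by omega))
    (fun s hs => (SSBE.initialPath_moments hmeas hψmom hs).2 _ (by omega))
  exact ⟨h1.trans (le_max_left _ _), h2.trans ((le_max_left _ _).trans (le_max_right _ _)),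
    h3.trans ((le_max_right _ _).trans (le_max_right _ _))⟩
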